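/- For $q>0$ and an integer $n\ge 1$, the $(n,q)$-Mallows measure $\mu_{n,q}$ on the symmetric group $S_n$ gives $\pi$ the probability $q^{\mathrm{inv}(\pi)}/Z_{n,q}$, where $\mathrm{inv}(\pi)=|\{(i,j): i<j,\ \pi(i)>\pi(j)\}|$ and $Z_{n,q}=\sum_{\sigma\in S_n}q^{\mathrm{inv}(\sigma)}$. Let $\mathrm{LDS}(\pi)$ be the maximal $m$ for which there are $i_1<\cdots<i_m$ with $\pi(i_1)>\cdots>\pi(i_m)$. **Theorem.** There exist absolute constants $C,c>0$ such that the following holds for all integers $n\ge 2$, all $0<q<1$ and $\pi\sim\mu_{n,q}$. (i) If $0<q<1-\frac2n$, then for every integer $L\ge 2$, $$\mathbb P(\mathrm{LDS}(\pi)\ge L)\le n^8\begin{cases}\left(\dfrac{C}{(1-q)L^2}\right)^L & \text{if } L\le \frac{3}{1-q},\\[2mm] (C(1-q))^L\,q^{\frac{L(L-1)}{2}} & \text{if } L>\frac{3}{1-q}.\end{cases}$$ Moreover, if $0<q<\frac12$, then for every integer $L\ge 2$, $$\mathbb P(\mathrm{LDS}(\pi)\ge L)\le n\,C^L q^{\frac{L(L-1)}{2}}.$$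 (ii) If $\frac12\le q\le 1-\frac4n$, then for every integer $L$ with $\frac{C}{\sqrt{1-q}}\le L\le\frac1{1-q}$, $$\mathbb P(\mathrm{LDS}(\pi)\ge L)\ge 1-\left(1-\left(\frac{c}{(1-q)L^2}\right)^L\right)^{\lfloor n(1-q)/4\rfloor}.$$ Moreover, for all $0<q<1$ and every integer $L\ge2$, $$\mathbb P(\mathrm{LDS}(\pi)\ge L)\ge 1-\left(1-q^{\frac{L(L-1)}{2}}(1-q)^L\right)^{\lfloor n/L\rfloor}.$$ (iii) If $\frac12\le q\le 1-\frac4n$, then for every integer $L$ with $2\le L<\frac{c}{\sqrt{1-q}}$, $$\mathbb P(\mathrm{LDS}(\pi)<L)\le \left(C(1-q)L^2\right)^{n/L}.$$ -/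

import Mathlib

namespace Mallows

/-- The number of inversions of a permutation: pairs `i < j` with `σ i > σ j`. -/
def inversions {n : ℕ} (σ : Equiv.Perm (Fin n)) : ℕ :=
  (Finset.univ.filter fun p : Fin n × Fin n => p.1 < p.2 ∧ σ p.2 < σ p.1).card

/-- The normalizing constant of the Mallows measure. -/
noncomputable def partitionFunction (n : ℕ) (q : ℝ) : ℝ :=
  ∑ σ : Equiv.Perm (Fin n), q ^ inversions σ

/-- The Mallows probability of a single permutation. -/
noncomputable def mass (n : ℕ) (q : ℝ) (σ : Equiv.Perm (Fin n)) : ℝ :=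
  q ^ inversions σ / partitionFunction n q

/-- The probability of an event (a set of permutations) under the `(n, q)`-Mallows measure. -/
noncomputable def prob (n : ℕ) (q : ℝ) (E : Set (Equiv.Perm (Fin n))) : ℝ :=
  ∑ σ : Equiv.Perm (Fin n), E.indicator (mass n q) σ

/-- The lengths `m` of the decreasing subsequences
`σ (i 0) > σ (i 1) > ⋯ > σ (i (m - 1))`, `i 0 < i 1 < ⋯ < i (m - 1)`. -/
def decreasingLengths {n : ℕ} (σ : Equiv.Perm (Fin n)) : Set ℕ :=
  {m | ∃ i : Fin m → Fin n, StrictMono i ∧ StrictAnti fun k => σ (i k)}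

/-- The length of a longest decreasing subsequence. -/
noncomputable def LDS {n : ℕ} (σ : Equiv.Perm (Fin n)) : ℕ :=
  sSup (decreasingLengths σ)

/-- The supremum in the definition of `LDS` is a maximum. -/
theorem isGreatest_LDS {n : ℕ} (σ : Equiv.Perm (Fin n)) :
    IsGreatest (decreasingLengths σ) (LDS σ) := by
  have hb : BddAbove (decreasingLengths σ) := by
    refine ⟨n, ?_⟩
    rintro m ⟨i, hi, -⟩
    simpa using Fintype.card_le_of_injective i hi.injective
  have hne : (decreasingLengths σ).Nonempty :=
    ⟨0, fun k => k.elim0, fun k => k.elim0, fun k => k.elim0⟩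
  exact ⟨Nat.sSup_mem hne hb, fun m hm => le_csSup hb hm⟩

theorem partitionFunction_pos (n : ℕ) {q : ℝ} (hq : 0 < q) : 0 < partitionFunction n q :=
  Finset.sum_pos (fun _ _ => pow_pos hq _) Finset.univ_nonempty

/-- For `q > 0` the Mallows masses add up to one. -/
theorem prob_univ (n : ℕ) {q : ℝ} (hq : 0 < q) : prob n q Set.univ = 1 := by
  simp only [prob, Set.indicator_univ, mass, ← Finset.sum_div]
  exact div_self (partitionFunction_pos n hq).ne'

end Mallows

namespace Mallows

/-! Upper bounds for a long decreasing subsequence are first moment bounds: the probability is at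
most the mean number M_L(n) of decreasing subsequences of length L. Given the image j (counted from
0) of the first position, the rest is a Mallows permutation, and so is the pattern of its values
below j. Hence M_{k+1}(n+1) - M_{k+1}(n) is the average of M_k(j) over a truncated geometric j
(`meanCount_succ`). Descending q-factorials solve this recurrence exactly, the coefficients being
elementary symmetric polynomials in explicit weights (`meanCount_eq_sum`). The weights are at most
1/((1-q)(i+1)(i+2)), which with a generating function bound settles short L; an induction that keeps
the powers of q settles long L.

For the lower bounds, patterns on disjoint intervals of positions are independent Mallows
permutations (`expect_combine`), so one block suffices. In a block of length about 4/(1-q) a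
decreasing subsequence is built greedily: each of L stages inspects up to d positions for one whose
value is among the d largest available, and succeeds with probability at least a constant over
(1-q)L^2 (`pow_le_prob_le_LDS`).

For short LDS, a permutation of length m with LDS < L is determined by at most L^(2m) labellings
(`card_LDS_lt_le`), each permutation has mass at most 1/Z_m, and Z_m is at least (m/27)^m for m
about 1/(1-q). Independent blocks again amplify the bound. -/

open Finset

/-! ### Inserting an entry into a permutation -/

/-- The permutation sending `i` to `j` and otherwise following the pattern `τ`. -/
def insertAt {n : ℕ} (i j : Fin (n + 1)) (τ : Equiv.Perm (Fin n)) : Equiv.Perm (Fin (n + 1)) :=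
  (finSuccEquiv' i).trans (τ.optionCongr.trans (finSuccEquiv' j).symm)

@[simp]
theorem insertAt_self {n : ℕ} (i j : Fin (n + 1)) (τ : Equiv.Perm (Fin n)) :
    insertAt i j τ i = j := by
  simp [insertAt]

@[simp]
theorem insertAt_succAbove {n : ℕ} (i j : Fin (n + 1)) (τ : Equiv.Perm (Fin n)) (a : Fin n) :
    insertAt i j τ (i.succAbove a) = j.succAbove (τ a) := by
  simp [insertAt]

theorem insertAt_left_bijective {n : ℕ} (i : Fin (n + 1)) :
    Function.Bijective fun p : Fin (n + 1) × Equiv.Perm (Fin n) => insertAt i p.1 p.2 := by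
  rw [Fintype.bijective_iff_injective_and_card]
  refine ⟨?_, by simp [Fintype.card_perm, Nat.factorial_succ]⟩
  rintro ⟨j, τ⟩ ⟨j', τ'⟩ h
  have hj : j = j' := by simpa using congrArg (fun σ => σ i) h
  subst hj
  refine Prod.ext rfl (Equiv.ext fun a => ?_)
  simpa using congrArg (fun σ => σ (i.succAbove a)) h

theorem insertAt_right_bijective {n : ℕ} (j : Fin (n + 1)) :
    Function.Bijective fun p : Fin (n + 1) × Equiv.Perm (Fin n) => insertAt p.1 j p.2 := by
  rw [Fintype.bijective_iff_injective_and_card]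
  refine ⟨?_, by simp [Fintype.card_perm, Nat.factorial_succ]⟩
  rintro ⟨i, τ⟩ ⟨i', τ'⟩ h
  have hi : i = i' := by
    apply (insertAt i' j τ').injective
    have := congrArg (fun σ => σ i) h
    simp only [insertAt_self] at this ⊢
    exact this.symm
  subst hi
  refine Prod.ext rfl (Equiv.ext fun a => ?_)
  simpa using congrArg (fun σ => σ (i.succAbove a)) h

theorem inversions_eq_sum {n : ℕ} (σ : Equiv.Perm (Fin n)) :
    inversions σ = ∑ a, ∑ b, if a < b ∧ σ b < σ a then 1 else 0 := by
  rw [inversions, card_filter, Fintype.sum_prod_type]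

theorem inversions_insertAt_zero {n : ℕ} (j : Fin (n + 1)) (τ : Equiv.Perm (Fin n)) :
    inversions (insertAt 0 j τ) = j + inversions τ := by
  have h1 : ∀ a b : Fin n, ((0 : Fin (n + 1)).succAbove a < (0 : Fin (n + 1)).succAbove b ∧
      j.succAbove (τ b) < j.succAbove (τ a)) ↔ (a < b ∧ τ b < τ a) := fun a b => by
    simp [Fin.succAbove_lt_succAbove_iff]
  have h2 : (∑ b : Fin n, if j.succAbove (τ b) < j then 1 else 0) = (j : ℕ) := by
    rw [Equiv.sum_comp τ (fun v => if j.succAbove v < j then 1 else 0), ← card_filter]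
    have : (univ.filter fun v : Fin n => j.succAbove v < j) =
        univ.filter fun v : Fin n => (v : ℕ) < j := by
      ext v
      simp only [Fin.succAbove_lt_iff_castSucc_lt, mem_filter, mem_univ, true_and]
      rfl
    rw [this, Fin.card_filter_val_lt]
    exact min_eq_right (Nat.lt_succ_iff.1 j.2)
  rw [inversions_eq_sum, inversions_eq_sum, Fin.sum_univ_succAbove _ (0 : Fin (n + 1))]
  simp only [Fin.sum_univ_succAbove _ (0 : Fin (n + 1)), insertAt_self, insertAt_succAbove, h1]
  simp [h2, Fin.succ_pos]

/-- The count of positions after `i` is left unevaluated: all that matters later is that it does not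
depend on `τ`. -/
theorem inversions_insertAt_last {n : ℕ} (i : Fin (n + 1)) (τ : Equiv.Perm (Fin n)) :
    inversions (insertAt i (Fin.last n) τ) =
      (∑ b : Fin n, if i < i.succAbove b then 1 else 0) + inversions τ := by
  have h3 : ∀ a : Fin n, ¬ Fin.last n < a.castSucc := fun a => not_lt.2 (Fin.le_last _)
  rw [inversions_eq_sum, inversions_eq_sum, Fin.sum_univ_succAbove _ i]
  simp [Fin.sum_univ_succAbove _ i, h3, Fin.castSucc_lt_last]

/-! ### Expectations and deletion of an entry -/

/-- The expectation of `f` under the Mallows measure. -/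
noncomputable def expect (n : ℕ) (q : ℝ) (f : Equiv.Perm (Fin n) → ℝ) : ℝ :=
  ∑ σ, mass n q σ * f σ

theorem expect_eq_div (n : ℕ) (q : ℝ) (f : Equiv.Perm (Fin n) → ℝ) :
    expect n q f = (∑ σ, q ^ inversions σ * f σ) / partitionFunction n q := by
  simp only [expect, mass, sum_div]
  exact sum_congr rfl fun σ _ => by ring

theorem prob_eq_expect (n : ℕ) (q : ℝ) (E : Set (Equiv.Perm (Fin n))) :
    prob n q E = expect n q (E.indicator 1) := by
  simp only [prob, expect]
  refine sum_congr rfl fun σ _ => ?_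
  by_cases h : σ ∈ E <;> simp [h]

theorem mass_nonneg (n : ℕ) {q : ℝ} (hq : 0 < q) (σ : Equiv.Perm (Fin n)) : 0 ≤ mass n q σ :=
  div_nonneg (pow_nonneg hq.le _) (partitionFunction_pos n hq).le

theorem expect_mono (n : ℕ) {q : ℝ} (hq : 0 < q) {f g : Equiv.Perm (Fin n) → ℝ}
    (h : ∀ σ, f σ ≤ g σ) : expect n q f ≤ expect n q g :=
  sum_le_sum fun σ _ => mul_le_mul_of_nonneg_left (h σ) (mass_nonneg n hq σ)

theorem expect_add (n : ℕ) (q : ℝ) (f g : Equiv.Perm (Fin n) → ℝ) :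
    expect n q (fun σ => f σ + g σ) = expect n q f + expect n q g := by
  simp [expect, mul_add, sum_add_distrib]

theorem expect_const (n : ℕ) {q : ℝ} (hq : 0 < q) (x : ℝ) : expect n q (fun _ => x) = x := by
  have := prob_univ n hq
  simp only [prob, Set.indicator_univ] at this
  rw [expect, ← sum_mul, this, one_mul]

theorem sum_insertAt_zero (n : ℕ) (q : ℝ) (f : Equiv.Perm (Fin (n + 1)) → ℝ) :
    ∑ σ, q ^ inversions σ * f σ =
      ∑ j : Fin (n + 1), q ^ (j : ℕ) * ∑ τ, q ^ inversions τ * f (insertAt 0 j τ) := by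
  rw [← (insertAt_left_bijective (0 : Fin (n + 1))).sum_comp
    (fun σ => q ^ inversions σ * f σ), Fintype.sum_prod_type]
  refine sum_congr rfl fun j _ => ?_
  rw [mul_sum]
  refine sum_congr rfl fun τ _ => ?_
  rw [inversions_insertAt_zero, pow_add, mul_assoc]

theorem partitionFunction_succ (n : ℕ) (q : ℝ) :
    partitionFunction (n + 1) q = (∑ j ∈ range (n + 1), q ^ j) * partitionFunction n q := by
  have := sum_insertAt_zero n q (fun _ => 1)
  simp only [mul_one] at this
  rw [partitionFunction, this, ← sum_mul, Fin.sum_univ_eq_sum_range (fun j => q ^ j)]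
  rfl

/-- Conditioning on the image of the first position. -/
theorem expect_succ (n : ℕ) (q : ℝ) (f : Equiv.Perm (Fin (n + 1)) → ℝ) :
    expect (n + 1) q f = (∑ j : Fin (n + 1), q ^ (j : ℕ) *
      expect n q (fun τ => f (insertAt 0 j τ))) / ∑ j ∈ range (n + 1), q ^ j := by
  rw [expect_eq_div, sum_insertAt_zero, partitionFunction_succ, mul_comm, ← div_div, sum_div]
  congr 1
  refine sum_congr rfl fun j _ => ?_
  rw [expect_eq_div, mul_div_assoc]

/-- Deleting the largest value of a Mallows permutation leaves a Mallows permutation. -/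
theorem expect_of_insertAt_last {n : ℕ} {q : ℝ} (hq : 0 < q) {f : Equiv.Perm (Fin (n + 1)) → ℝ}
    {g : Equiv.Perm (Fin n) → ℝ} (h : ∀ i τ, f (insertAt i (Fin.last n) τ) = g τ) :
    expect (n + 1) q f = expect n q g := by
  -- The total weight `K` of the inversions made by the largest value is common to all `f`, so `f =
  -- 1` gives the same `K` in the partition function and it cancels.
  obtain ⟨K, hK⟩ : ∃ K : ℝ, ∀ (f : Equiv.Perm (Fin (n + 1)) → ℝ) (g : Equiv.Perm (Fin n) → ℝ),
      (∀ i τ, f (insertAt i (Fin.last n) τ) = g τ) →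
      ∑ σ, q ^ inversions σ * f σ = K * ∑ τ, q ^ inversions τ * g τ := by
    refine ⟨∑ i : Fin (n + 1), q ^ (∑ b : Fin n, if i < i.succAbove b then 1 else 0),
      fun f g h => ?_⟩
    rw [← (insertAt_right_bijective (Fin.last n)).sum_comp
      (fun σ => q ^ inversions σ * f σ), Fintype.sum_prod_type, sum_mul]
    refine sum_congr rfl fun i _ => ?_
    rw [mul_sum]
    refine sum_congr rfl fun τ _ => ?_
    rw [inversions_insertAt_last, pow_add, mul_assoc, h]
  have hZ : partitionFunction (n + 1) q = K * partitionFunction n q := by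
    simpa [partitionFunction] using hK (fun _ => 1) (fun _ => 1) (fun _ _ => rfl)
  have h0 := partitionFunction_pos (n + 1) hq
  rw [expect_eq_div, expect_eq_div, hK f g h, hZ, mul_div_mul_left]
  rintro rfl
  simp [hZ] at h0

/-! ### Decreasing subsequences and the recurrence for their mean number -/

/-- The decreasing subsequences of length `k` with values below `c`, as sets of positions. -/
def decSets {n : ℕ} (k c : ℕ) (σ : Equiv.Perm (Fin n)) : Finset (Finset (Fin n)) :=
  univ.filter fun s => s.card = k ∧ (∀ a ∈ s, ∀ b ∈ s, a < b → σ b < σ a) ∧ ∀ a ∈ s, (σ a : ℕ) < c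

theorem mem_decSets {n k c : ℕ} {σ : Equiv.Perm (Fin n)} {s : Finset (Fin n)} :
    s ∈ decSets k c σ ↔
      s.card = k ∧ (∀ a ∈ s, ∀ b ∈ s, a < b → σ b < σ a) ∧ ∀ a ∈ s, (σ a : ℕ) < c := by
  simp [decSets]

theorem map_mem_decSets_insertAt {n k c : ℕ} {i j : Fin (n + 1)} {τ : Equiv.Perm (Fin n)}
    {s : Finset (Fin n)} :
    s.map i.succAboveEmb ∈ decSets k c (insertAt i j τ) ↔
      s.card = k ∧ (∀ a ∈ s, ∀ b ∈ s, a < b → τ b < τ a) ∧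
        ∀ a ∈ s, (j.succAbove (τ a) : ℕ) < c := by
  simp [mem_decSets, Fin.succAbove_lt_succAbove_iff]

theorem exists_map_succAbove {n : ℕ} {i : Fin (n + 1)} {s : Finset (Fin (n + 1))} (hi : i ∉ s) :
    ∃ t : Finset (Fin n), t.map i.succAboveEmb = s := by
  refine ⟨univ.filter fun a => i.succAbove a ∈ s, ?_⟩
  ext x
  simp only [mem_map, mem_filter, mem_univ, true_and, Fin.coe_succAboveEmb]
  constructor
  · rintro ⟨a, ha, rfl⟩
    exact ha
  · intro hx
    obtain ⟨a, rfl⟩ := Fin.exists_succAbove_eq (x := x) (y := i) (fun h => hi (h ▸ hx))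
    exact ⟨a, hx, rfl⟩

theorem card_decSets_insertAt_last {n k c : ℕ} (hc : c ≤ n) (i : Fin (n + 1))
    (τ : Equiv.Perm (Fin n)) :
    (decSets k c (insertAt i (Fin.last n) τ)).card = (decSets k c τ).card := by
  symm
  refine card_bij (fun s _ => s.map i.succAboveEmb) (fun s hs => ?_)
    (fun s _ t _ h => map_injective _ h) (fun s hs => ?_)
  · rw [map_mem_decSets_insertAt]
    simpa [mem_decSets] using hs
  · have hi : i ∉ s := fun hi => by
      have := (mem_decSets.1 hs).2.2 i hi
      simp at this
      omega
    obtain ⟨t, rfl⟩ := exists_map_succAbove hi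
    rw [map_mem_decSets_insertAt] at hs
    exact ⟨t, by simpa [mem_decSets] using hs, rfl⟩

/-- Subsequences are split by whether they use the first position. Those that do continue with
values below `j`, which is why `decSets` carries a threshold. -/
theorem card_decSets_insertAt_zero {n k : ℕ} (j : Fin (n + 1)) (τ : Equiv.Perm (Fin n)) :
    (decSets (k + 1) (n + 1) (insertAt 0 j τ)).card =
      (decSets (k + 1) n τ).card + (decSets k j τ).card := by
  rw [← card_filter_add_card_filter_not (fun s => (0 : Fin (n + 1)) ∉ s)]
  congr 1
  · symm
    refine card_bij (fun s _ => s.map (Fin.succAboveEmb 0)) (fun s hs => ?_)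
      (fun s _ t _ h => map_injective _ h) (fun s hs => ?_)
    · rw [mem_filter, map_mem_decSets_insertAt]
      have := mem_decSets.1 hs
      exact ⟨⟨this.1, this.2.1, fun a _ => Fin.is_lt _⟩, by simp⟩
    · rw [mem_filter] at hs
      obtain ⟨t, rfl⟩ := exists_map_succAbove hs.2
      have := map_mem_decSets_insertAt.1 hs.1
      exact ⟨t, mem_decSets.2 ⟨this.1, this.2.1, fun a _ => Fin.is_lt _⟩, rfl⟩
  · have h0 : ∀ t : Finset (Fin n), (0 : Fin (n + 1)) ∉ t.map (Fin.succAboveEmb 0) := by simp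
    symm
    refine card_bij (fun s _ => cons 0 (s.map (Fin.succAboveEmb 0)) (h0 s)) (fun s hs => ?_)
      (fun s _ t _ h => ?_) (fun s hs => ?_)
    · obtain ⟨h1, h2, h3⟩ := mem_decSets.1 hs
      simp only [mem_filter, mem_decSets, card_cons, card_map, h1, true_and, mem_cons, mem_map,
        Fin.coe_succAboveEmb, Fin.zero_succAbove, true_or, not_true, not_false_iff, and_true]
      refine ⟨?_, fun a _ => Fin.is_lt _⟩
      rintro a (rfl | ⟨a, ha, rfl⟩) b (rfl | ⟨b, hb, rfl⟩) hab
      · exact absurd hab (lt_irrefl _)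
      · rw [insertAt_self, ← Fin.zero_succAbove, insertAt_succAbove,
          Fin.succAbove_lt_iff_castSucc_lt]
        exact h3 b hb
      · exact absurd hab (Fin.not_lt_zero _)
      · rw [← Fin.zero_succAbove, ← Fin.zero_succAbove, insertAt_succAbove, insertAt_succAbove,
          Fin.succAbove_lt_succAbove_iff]
        exact h2 a ha b hb (Fin.succ_lt_succ_iff.1 hab)
    · have := congrArg (fun s => s.erase 0) h
      simp only [cons_eq_insert, erase_insert (h0 _)] at this
      exact map_injective _ this
    · rw [mem_filter, not_not] at hs
      obtain ⟨t, ht⟩ := exists_map_succAbove (notMem_erase 0 s)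
      have hs' : cons 0 (t.map (Fin.succAboveEmb 0)) (h0 t) = s := by
        rw [cons_eq_insert, ht, insert_erase hs.2]
      refine ⟨t, ?_, hs'⟩
      obtain ⟨h1, h2, -⟩ := mem_decSets.1 hs.1
      rw [mem_decSets]
      have hmem : ∀ a ∈ t, (0 : Fin (n + 1)).succAbove a ∈ s := fun a ha => by
        rw [← hs']
        exact mem_cons_of_mem (mem_map_of_mem (Fin.succAboveEmb 0) ha)
      refine ⟨?_, fun a ha b hb hab => ?_, fun a ha => ?_⟩
      · rw [← hs', card_cons, card_map] at h1
        omega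
      · have := h2 _ (hmem a ha) _ (hmem b hb) (by simpa using hab)
        rwa [insertAt_succAbove, insertAt_succAbove, Fin.succAbove_lt_succAbove_iff] at this
      · have := h2 0 hs.2 _ (hmem a ha) (by simp)
        rw [insertAt_self, insertAt_succAbove, Fin.succAbove_lt_iff_castSucc_lt] at this
        exact this

/-- The small values of a Mallows permutation form a Mallows permutation. -/
theorem expect_card_decSets_of_le {n c : ℕ} {q : ℝ} (hq : 0 < q) (hc : c ≤ n) (k : ℕ)
    (φ : ℕ → ℝ) :
    expect n q (fun σ => φ (decSets k c σ).card) = expect c q (fun σ => φ (decSets k c σ).card) := by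
  induction n, hc using Nat.le_induction with
  | base => rfl
  | succ n hn ih =>
    rw [← ih]
    exact expect_of_insertAt_last hq fun i τ => by rw [card_decSets_insertAt_last hn]

theorem le_LDS_iff {n L : ℕ} {σ : Equiv.Perm (Fin n)} :
    L ≤ LDS σ ↔ 0 < (decSets L n σ).card := by
  rw [card_pos]
  constructor
  · intro h
    obtain ⟨⟨i, hi, hi'⟩, -⟩ := isGreatest_LDS σ
    refine ⟨univ.map ((Fin.castLEEmb h).trans ⟨i, hi.injective⟩), mem_decSets.2 ⟨by simp, ?_,
      fun a _ => Fin.is_lt _⟩⟩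
    intro a ha b hb hab
    simp only [mem_map, mem_univ, true_and] at ha hb
    obtain ⟨a, rfl⟩ := ha
    obtain ⟨b, rfl⟩ := hb
    exact hi' (hi.lt_iff_lt.1 hab)
  · rintro ⟨s, hs⟩
    obtain ⟨h1, h2, -⟩ := mem_decSets.1 hs
    refine (isGreatest_LDS σ).2 ⟨s.orderEmbOfFin h1, (s.orderEmbOfFin h1).strictMono, ?_⟩
    intro a b hab
    exact h2 _ (orderEmbOfFin_mem _ _ _) _ (orderEmbOfFin_mem _ _ _)
      ((s.orderEmbOfFin h1).strictMono hab)

/-- The expected number of decreasing subsequences of length `k` of a Mallows permutation. -/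
noncomputable def meanCount (q : ℝ) (k n : ℕ) : ℝ :=
  expect n q fun σ => ((decSets k n σ).card : ℝ)

theorem meanCount_zero_left {q : ℝ} (hq : 0 < q) (n : ℕ) : meanCount q 0 n = 1 := by
  have : ∀ σ : Equiv.Perm (Fin n), decSets 0 n σ = {∅} := fun σ => by
    ext s
    simp only [mem_decSets, card_eq_zero, mem_singleton]
    constructor
    · exact fun h => h.1
    · rintro rfl
      simp
  simp [meanCount, this, expect_const n hq]

theorem meanCount_zero_right (q : ℝ) (k : ℕ) : meanCount q (k + 1) 0 = 0 := by
  have : ∀ σ : Equiv.Perm (Fin 0), decSets (k + 1) 0 σ = ∅ := fun σ => by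
    ext s
    simp [mem_decSets, Subsingleton.elim s ∅]
  simp [meanCount, this, expect]

theorem geom_pos {q : ℝ} (hq : 0 < q) (n : ℕ) : 0 < ∑ j ∈ range (n + 1), q ^ j :=
  sum_pos (fun _ _ => pow_pos hq _) ⟨0, by simp⟩

theorem meanCount_succ {q : ℝ} (hq : 0 < q) (k n : ℕ) :
    meanCount q (k + 1) (n + 1) = meanCount q (k + 1) n +
      (∑ c ∈ range (n + 1), q ^ c * meanCount q k c) / ∑ j ∈ range (n + 1), q ^ j := by
  have h : ∀ j : Fin (n + 1), expect n q (fun τ =>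
      ((decSets (k + 1) (n + 1) (insertAt 0 j τ)).card : ℝ)) =
      meanCount q (k + 1) n + meanCount q k j := fun j => by
    simp only [card_decSets_insertAt_zero, Nat.cast_add]
    rw [expect_add, expect_card_decSets_of_le hq (Nat.lt_succ_iff.1 j.2) k (fun x => (x : ℝ))]
    rfl
  rw [meanCount, expect_succ]
  simp only [h]
  rw [Fin.sum_univ_eq_sum_range (fun j => q ^ j * (meanCount q (k + 1) n + meanCount q k j))]
  simp only [mul_add, sum_add_distrib, ← sum_mul]
  rw [add_div, mul_div_cancel_left₀ _ (geom_pos hq n).ne']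

theorem prob_le_LDS_le_meanCount {q : ℝ} (hq : 0 < q) (n L : ℕ) :
    prob n q {σ | L ≤ LDS σ} ≤ meanCount q L n := by
  rw [prob_eq_expect]
  refine expect_mono n hq fun σ => ?_
  by_cases h : L ≤ LDS σ
  · rw [Set.indicator_of_mem (by exact h)]
    exact Nat.one_le_cast.2 (le_LDS_iff.1 h)
  · rw [Set.indicator_of_notMem (by exact h)]
    positivity

/-! ### Exact solution of the recurrence in descending q-factorials -/

/-- The descending `q`-factorial `(1 - q ^ n) (1 - q ^ (n - 1)) ⋯ (1 - q ^ (n - m + 1))`. -/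
noncomputable def qDesc (q : ℝ) (m n : ℕ) : ℝ := ∏ i ∈ range m, (1 - q ^ (n - i))

theorem qDesc_zero_left (q : ℝ) (n : ℕ) : qDesc q 0 n = 1 := by simp [qDesc]

theorem qDesc_succ_succ (q : ℝ) (m n : ℕ) :
    qDesc q (m + 1) (n + 1) = (1 - q ^ (n + 1)) * qDesc q m n := by
  rw [qDesc, prod_range_succ', mul_comm]
  simp [qDesc]

theorem qDesc_succ_left (q : ℝ) (m n : ℕ) :
    qDesc q (m + 1) n = (1 - q ^ (n - m)) * qDesc q m n := by
  rw [qDesc, prod_range_succ, mul_comm, qDesc]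

/-- The factor with `i = n` is `1 - q ^ 0`. Sums over `m` may therefore be extended past `n`. -/
theorem qDesc_eq_zero (q : ℝ) {m n : ℕ} (h : n < m) : qDesc q m n = 0 :=
  prod_eq_zero (mem_range.2 h) (by simp)

theorem qDesc_nonneg {q : ℝ} (h0 : 0 < q) (h1 : q < 1) (m n : ℕ) : 0 ≤ qDesc q m n :=
  prod_nonneg fun _ _ => sub_nonneg.2 (pow_le_one₀ h0.le h1.le)

theorem qDesc_le_one {q : ℝ} (h0 : 0 < q) (h1 : q < 1) (m n : ℕ) : qDesc q m n ≤ 1 :=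
  prod_le_one (fun _ _ => sub_nonneg.2 (pow_le_one₀ h0.le h1.le))
    fun _ _ => sub_le_self _ (pow_nonneg h0.le _)

theorem qDesc_sub (q : ℝ) (m n : ℕ) :
    qDesc q (m + 1) (n + 1) - qDesc q (m + 1) n = q ^ (n - m) * (1 - q ^ (m + 1)) * qDesc q m n := by
  rcases lt_or_ge n m with h | h
  · rw [qDesc_eq_zero q h, qDesc_eq_zero q (by omega : n + 1 < m + 1),
      qDesc_eq_zero q (by omega : n < m + 1)]
    ring
  · rw [qDesc_succ_succ, qDesc_succ_left]
    obtain ⟨d, rfl⟩ := Nat.exists_eq_add_of_le h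
    rw [Nat.add_sub_cancel_left]
    ring

theorem one_sub_pow_pos {q : ℝ} (h0 : 0 < q) (h1 : q < 1) (n : ℕ) : 0 < 1 - q ^ (n + 1) :=
  sub_pos.2 (pow_lt_one₀ h0.le h1 n.succ_ne_zero)

/-- The difference formula `qDesc_sub`, multiplied by `q ^ m`, telescopes. -/
theorem sum_pow_mul_qDesc {q : ℝ} (m n : ℕ) :
    (1 - q ^ (m + 1)) * ∑ c ∈ range n, q ^ c * qDesc q m c = q ^ m * qDesc q (m + 1) n := by
  induction n with
  | zero => simp [qDesc_eq_zero q m.succ_pos]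
  | succ n ih =>
    rw [sum_range_succ, mul_add, ih]
    have h := qDesc_sub q m n
    rcases lt_or_ge n m with h' | h'
    · rw [qDesc_eq_zero q h', qDesc_eq_zero q (by omega : n + 1 < m + 1),
        qDesc_eq_zero q (by omega : n < m + 1)]
      ring
    · obtain ⟨d, rfl⟩ := Nat.exists_eq_add_of_le h'
      rw [Nat.add_sub_cancel_left] at h
      rw [pow_add]
      linear_combination (-q ^ m) * h

/-- The weights whose elementary symmetric polynomials govern the mean number of decreasing
subsequences; the weight of index `i` is `(1 - q) q ^ (i + 1) / ((1 - q ^ (i + 1)) (1 - q ^ (i + 2)))`. -/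
noncomputable def weight (q : ℝ) (i : ℕ) : ℝ :=
  (1 - q) * q ^ (i + 1) / ((1 - q ^ (i + 1)) * (1 - q ^ (i + 2)))

theorem weight_nonneg {q : ℝ} (h0 : 0 < q) (h1 : q < 1) (i : ℕ) : 0 ≤ weight q i := by
  have := one_sub_pow_pos h0 h1 i
  have := one_sub_pow_pos h0 h1 (i + 1)
  have : 0 < 1 - q := sub_pos.2 h1
  unfold weight
  positivity

/-- The elementary symmetric polynomial of degree `k` in the first `l` terms of `w`. -/
noncomputable def elemSymm (w : ℕ → ℝ) : ℕ → ℕ → ℝ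
  | 0, _ => 1
  | _ + 1, 0 => 0
  | k + 1, l + 1 => elemSymm w (k + 1) l + w l * elemSymm w k l

theorem elemSymm_nonneg {w : ℕ → ℝ} (hw : ∀ i, 0 ≤ w i) (k l : ℕ) : 0 ≤ elemSymm w k l := by
  induction l generalizing k with
  | zero => cases k <;> simp [elemSymm]
  | succ l ih =>
    cases k with
    | zero => simp [elemSymm]
    | succ k =>
      rw [elemSymm]
      have := ih (k + 1)
      have := ih k
      have := hw l
      positivity

theorem elemSymm_monotone {w : ℕ → ℝ} (hw : ∀ i, 0 ≤ w i) (k : ℕ) :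
    Monotone (elemSymm w k) := by
  refine monotone_nat_of_le_succ fun l => ?_
  cases k with
  | zero => simp [elemSymm]
  | succ k =>
    rw [elemSymm.eq_3]
    exact le_add_of_nonneg_right (mul_nonneg (hw l) (elemSymm_nonneg hw k l))

/-- The coefficients of the mean count in the basis of descending `q`-factorials. -/
noncomputable def meanCoeff (q : ℝ) : ℕ → ℕ → ℝ
  | 0, 0 => 1
  | 0, _ + 1 => 0
  | _ + 1, 0 => 0
  | k + 1, m + 1 => elemSymm (weight q) k m / (1 - q ^ (m + 1))

/-- The averaging step multiplies the coefficient of `qDesc q m` by (1-q)q^m/(1-q^(m+1)). The new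
summand at m = l+1 is `weight q l` times the polynomial of degree one less, which is the recursion
of `elemSymm`; this dictates the form of the weights. -/
theorem sum_meanCoeff {q : ℝ} (h0 : 0 < q) (h1 : q < 1) (k l : ℕ) :
    ∑ m ∈ range (l + 1), (1 - q) * q ^ m / (1 - q ^ (m + 1)) * meanCoeff q k m =
      elemSymm (weight q) k l := by
  have hq : 1 - q ≠ 0 := (sub_pos.2 h1).ne'
  rw [sum_range_succ']
  cases k with
  | zero => simp [meanCoeff, elemSymm, hq]
  | succ k =>
    simp only [meanCoeff, mul_zero, add_zero]
    induction l with
    | zero => simp [elemSymm]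
    | succ l ih =>
      rw [sum_range_succ, ih, elemSymm, weight]
      have := (one_sub_pow_pos h0 h1 l).ne'
      have := (one_sub_pow_pos h0 h1 (l + 1)).ne'
      field_simp

/-- Summation by parts, which matches the increment of the mean count with the averaged sum. -/
theorem sum_partialSum_mul_sub (a B : ℕ → ℝ) (N : ℕ) :
    ∑ l ∈ range (N + 1), (∑ m ∈ range (l + 1), a m) * (B l - B (l + 1)) +
      (∑ m ∈ range (N + 1), a m) * B (N + 1) = ∑ m ∈ range (N + 1), a m * B m := by
  induction N with
  | zero =>
    simp only [zero_add, sum_range_one]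
    ring
  | succ N ih =>
    rw [sum_range_succ _ (N + 1), sum_range_succ (fun m => a m * B m), ← ih,
      sum_range_succ a (N + 1)]
    ring

/-- The expansion of the mean count in descending `q`-factorials. -/
theorem meanCount_eq_sum {q : ℝ} (h0 : 0 < q) (h1 : q < 1) (k n : ℕ) :
    meanCount q k n = ∑ m ∈ range (n + 1), meanCoeff q k m * qDesc q m n := by
  induction k generalizing n with
  | zero =>
    rw [meanCount_zero_left h0, sum_range_succ']
    simp [meanCoeff, qDesc_zero_left]
  | succ k ihk =>
    induction n with
    | zero => simp [meanCount_zero_right, meanCoeff]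
    | succ n ihn =>
      rw [meanCount_succ h0, ihn]
      have hL : ∑ m ∈ range (n + 1 + 1), meanCoeff q (k + 1) m * qDesc q m (n + 1) -
          ∑ m ∈ range (n + 1), meanCoeff q (k + 1) m * qDesc q m n =
          ∑ l ∈ range (n + 1), elemSymm (weight q) k l * (qDesc q l n - qDesc q (l + 1) n) := by
        have : ∑ m ∈ range (n + 1), meanCoeff q (k + 1) m * qDesc q m n =
            ∑ m ∈ range (n + 1 + 1), meanCoeff q (k + 1) m * qDesc q m n := by
          rw [sum_range_succ _ (n + 1), qDesc_eq_zero q n.lt_succ_self, mul_zero, add_zero]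
        rw [this, ← sum_sub_distrib, sum_range_succ']
        simp only [meanCoeff, zero_mul, sub_zero, add_zero, ← mul_sub]
        refine sum_congr rfl fun l hl => ?_
        rw [qDesc_sub, qDesc_succ_left]
        have := (one_sub_pow_pos h0 h1 l).ne'
        field_simp
        ring
      have hR : (∑ c ∈ range (n + 1), q ^ c * meanCount q k c) / ∑ j ∈ range (n + 1), q ^ j =
          ∑ m ∈ range (n + 1),
            ((1 - q) * q ^ m / (1 - q ^ (m + 1)) * meanCoeff q k m) * qDesc q m n := by
        have h2 : ∀ c ∈ range (n + 1), q ^ c * meanCount q k c =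
            ∑ m ∈ range (n + 1), meanCoeff q k m * (q ^ c * qDesc q m c) := fun c hc => by
          rw [ihk, mul_sum]
          -- The range is enlarged to one independent of `c`, the added terms being zero, so that
          -- the two sums can be exchanged.
          refine (sum_subset (range_mono (by simpa using hc)) fun m _ hm => ?_).trans
            (sum_congr rfl fun m _ => by ring)
          rw [qDesc_eq_zero q (by simpa using hm)]
          ring
        rw [sum_congr rfl h2, sum_comm, sum_div]
        refine sum_congr rfl fun m _ => ?_
        rw [← mul_sum]
        have h3 := sum_pow_mul_qDesc (q := q) m (n + 1)
        rw [qDesc_succ_succ] at h3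
        have h4 := geom_sum_mul_neg q (n + 1)
        have h5 := (one_sub_pow_pos h0 h1 m).ne'
        have h6 := (geom_pos h0 n).ne'
        rw [← h4] at h3
        rw [div_eq_iff h6, eq_comm]
        field_simp
        linear_combination (-meanCoeff q k m) * h3
      have hA := sum_partialSum_mul_sub
        (fun m => (1 - q) * q ^ m / (1 - q ^ (m + 1)) * meanCoeff q k m) (fun m => qDesc q m n) n
      simp only [sum_meanCoeff h0 h1] at hA
      rw [qDesc_eq_zero q n.lt_succ_self, mul_zero, add_zero] at hA
      rw [hR, ← hA, ← hL]
      ring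

theorem meanCount_le {q : ℝ} (h0 : 0 < q) (h1 : q < 1) (k n : ℕ) :
    meanCount q (k + 1) n ≤ n / (1 - q) * elemSymm (weight q) k n := by
  have hw := weight_nonneg h0 h1
  have hq : 0 < 1 - q := sub_pos.2 h1
  rw [meanCount_eq_sum h0 h1, sum_range_succ']
  simp only [meanCoeff, zero_mul, add_zero]
  calc _ ≤ ∑ _l ∈ range n, elemSymm (weight q) k n / (1 - q) := by
        refine sum_le_sum fun l hl => ?_
        have h2 : 1 - q ≤ 1 - q ^ (l + 1) :=
          sub_le_sub_left (pow_le_of_le_one h0.le h1.le l.succ_ne_zero) _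
        refine (mul_le_of_le_one_right ?_ (qDesc_le_one h0 h1 _ _)).trans ?_
        · exact div_nonneg (elemSymm_nonneg hw _ _) (hq.le.trans h2)
        · exact div_le_div₀ (elemSymm_nonneg hw _ _)
            (elemSymm_monotone hw k (mem_range.1 hl).le) hq h2
    _ = _ := by
        rw [sum_const, card_range, nsmul_eq_mul]
        ring

/-! ### Estimates of the elementary symmetric polynomials and the mean count -/

/-- The generating function bound for elementary symmetric polynomials. -/
theorem pow_mul_elemSymm_le {w : ℕ → ℝ} (hw : ∀ i, 0 ≤ w i) {t : ℝ} (ht : 0 ≤ t) (k l : ℕ) :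
    t ^ k * elemSymm w k l ≤ ∏ i ∈ range l, (1 + t * w i) := by
  have hp : ∀ l, 0 ≤ ∏ i ∈ range l, (1 + t * w i) := fun l =>
    prod_nonneg fun i _ => by have := hw i; positivity
  induction l generalizing k with
  | zero => cases k <;> simp [elemSymm]
  | succ l ih =>
    rw [prod_range_succ]
    have hl := mul_nonneg ht (hw l)
    cases k with
    | zero =>
      have := ih 0
      simp only [elemSymm, pow_zero, mul_one] at this ⊢
      nlinarith [hp l]
    | succ k =>
      rw [elemSymm]
      have h2 := ih (k + 1)
      have h3 := mul_le_mul_of_nonneg_left (ih k) hl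
      rw [pow_succ] at h2 ⊢
      nlinarith

/-- After division by 1-q this is AM-GM: the terms q^j and q^(2n-1-j) of the geometric sum add up to
at least 2q^n. -/
theorem two_mul_mul_pow_le {q : ℝ} (h0 : 0 < q) (h1 : q < 1) (n : ℕ) :
    2 * n * (1 - q) * q ^ n ≤ 1 - q ^ (2 * n) := by
  have hq : 0 < 1 - q := sub_pos.2 h1
  induction n with
  | zero => simp
  | succ n ih =>
    have hx : 0 < q ^ n := pow_pos h0 n
    have h2 : 2 * q ^ (n + 1) ≤ 1 + q ^ (2 * n + 1) := by
      have e : q ^ (2 * n + 1) = q * (q ^ n) ^ 2 := by ring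
      rw [e, pow_succ]
      nlinarith [sq_nonneg (1 - q * q ^ n), mul_pos hq (mul_pos h0 (mul_pos hx hx))]
    have e : 1 - q ^ (2 * (n + 1)) = (1 - q) * (1 + q ^ (2 * n + 1)) + q * (1 - q ^ (2 * n)) := by
      ring
    rw [e]
    push_cast
    have h3 := mul_le_mul_of_nonneg_left h2 hq.le
    have h4 := mul_le_mul_of_nonneg_left ih h0.le
    rw [pow_succ] at h3 ⊢
    nlinarith

/-- The right side for n+1 is q times that for n plus (1-q)(1-q^(2(n+1))), and the previous lemma
bounds this increment without half-integer powers of q. -/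
theorem mul_sq_mul_pow_le {q : ℝ} (h0 : 0 < q) (h1 : q < 1) (n : ℕ) :
    n * (n + 1) * (1 - q) ^ 2 * q ^ n ≤ (1 - q ^ n) * (1 - q ^ (n + 1)) := by
  have hq : 0 < 1 - q := sub_pos.2 h1
  induction n with
  | zero => simp
  | succ n ih =>
    have e : (1 - q ^ (n + 1)) * (1 - q ^ (n + 1 + 1)) =
        q * ((1 - q ^ n) * (1 - q ^ (n + 1))) + (1 - q) * (1 - q ^ (2 * (n + 1))) := by
      ring
    rw [e]
    have h3 := mul_le_mul_of_nonneg_left (two_mul_mul_pow_le h0 h1 (n + 1)) hq.le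
    have h4 := mul_le_mul_of_nonneg_left ih h0.le
    push_cast at h3 ⊢
    refine le_trans (le_of_eq ?_) (add_le_add h4 h3)
    ring

theorem weight_le {q : ℝ} (h0 : 0 < q) (h1 : q < 1) (i : ℕ) :
    weight q i ≤ 1 / ((1 - q) * ((i + 1) * (i + 2))) := by
  have hq : 0 < 1 - q := sub_pos.2 h1
  have h2 := one_sub_pow_pos h0 h1 i
  have h3 := one_sub_pow_pos h0 h1 (i + 1)
  have h := mul_sq_mul_pow_le h0 h1 (i + 1)
  push_cast at h
  rw [weight, div_le_div_iff₀ (mul_pos h2 h3) (by positivity)]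
  refine le_trans (le_of_eq ?_) (h.trans_eq ?_) <;> ring

theorem exp_natCast_le (k : ℕ) : Real.exp k ≤ 3 ^ k := by
  rw [← Real.exp_one_pow]
  exact pow_le_pow_left₀ (Real.exp_pos 1).le (Real.exp_one_lt_d9.le.trans (by norm_num)) k

theorem pow_self_le (k : ℕ) : (k : ℝ) ^ k ≤ 3 ^ k * k.factorial := by
  have h := Real.pow_div_factorial_le_exp (k : ℝ) (Nat.cast_nonneg k) k
  rw [div_le_iff₀ (by positivity)] at h
  exact h.trans (by gcongr; exact exp_natCast_le k)

/-- The first k factors are at most 2k^2/(i+1)^2 and multiply to at most 18^k by Stirling; the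
remaining ones are bounded by the exponential of a telescoping sum that is at most k. -/
theorem prod_one_add_sq_div_le (k l : ℕ) :
    ∏ i ∈ range l, (1 + (k : ℝ) ^ 2 / ((i + 1) * (i + 2))) ≤ 54 ^ k := by
  have h1 : ∏ i ∈ range k, (1 + (k : ℝ) ^ 2 / ((i + 1) * (i + 2))) ≤ 18 ^ k := by
    calc _ ≤ ∏ i ∈ range k, (2 * (k : ℝ) ^ 2 / ((i : ℝ) + 1) ^ 2) := by
          refine prod_le_prod (fun i _ => by positivity) fun i hi => ?_
          have hik : (i : ℝ) + 1 ≤ k := by exact_mod_cast mem_range.1 hi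
          have h2 : 1 ≤ (k : ℝ) ^ 2 / ((i : ℝ) + 1) ^ 2 := by
            rw [one_le_div (by positivity)]
            gcongr
          have h3 : (k : ℝ) ^ 2 / ((i + 1) * (i + 2)) ≤ (k : ℝ) ^ 2 / ((i : ℝ) + 1) ^ 2 := by
            gcongr
            nlinarith [(Nat.cast_nonneg i : (0 : ℝ) ≤ i)]
          rw [mul_div_assoc]
          linarith
      _ = 2 ^ k * ((k : ℝ) ^ k / k.factorial) ^ 2 := by
          rw [prod_div_distrib, prod_const, card_range, prod_pow, mul_pow,
            ← prod_range_add_one_eq_factorial]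
          push_cast
          rw [div_pow, mul_div_assoc]
          ring
      _ ≤ 2 ^ k * (3 ^ k) ^ 2 := by
          gcongr
          rw [div_le_iff₀ (by positivity)]
          exact pow_self_le k
      _ = 18 ^ k := by
          rw [← pow_mul, mul_comm k 2, pow_mul, ← mul_pow]
          norm_num
  have h2 : ∏ j ∈ range l, (1 + (k : ℝ) ^ 2 / (((k + j : ℕ) + 1) * ((k + j : ℕ) + 2))) ≤
      Real.exp ((k : ℝ) ^ 2 / (k + 1) - (k : ℝ) ^ 2 / (k + l + 1)) := by
    induction l with
    | zero => simp
    | succ l ih =>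
      rw [prod_range_succ]
      have h3 := Real.add_one_le_exp ((k : ℝ) ^ 2 / (((k + l : ℕ) + 1) * ((k + l : ℕ) + 2)))
      refine (mul_le_mul ih ((add_comm _ _).trans_le h3) (by positivity)
        (Real.exp_pos _).le).trans_eq ?_
      rw [← Real.exp_add]
      congr 1
      push_cast
      field_simp
      ring
  have h3 : (k : ℝ) ^ 2 / (k + 1) - (k : ℝ) ^ 2 / (k + l + 1) ≤ k := by
    have : (k : ℝ) ^ 2 / (k + 1) ≤ k := by
      rw [div_le_iff₀ (by positivity)]
      nlinarith [(Nat.cast_nonneg k : (0 : ℝ) ≤ k)]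
    have : 0 ≤ (k : ℝ) ^ 2 / (k + l + 1) := by positivity
    linarith
  have h4 := h2.trans ((Real.exp_le_exp.2 h3).trans (exp_natCast_le k))
  calc _ ≤ ∏ i ∈ range (k + l), (1 + (k : ℝ) ^ 2 / ((i + 1) * (i + 2))) := by
        refine prod_le_prod_of_subset_of_one_le (range_mono (Nat.le_add_left _ _))
          (fun i _ => by positivity) fun i _ _ => ?_
        exact le_add_of_nonneg_right (by positivity)
    _ ≤ 18 ^ k * 3 ^ k := by
        rw [prod_range_add]
        exact mul_le_mul h1 h4 (prod_nonneg fun i _ => by positivity) (by positivity)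
    _ = 54 ^ k := by
        rw [← mul_pow]
        norm_num

/-- The generating function is evaluated at t = (1-q)k^2, where t times the weight bound is
k^2/((i+1)(i+2)). -/
theorem elemSymm_weight_le {q : ℝ} (h0 : 0 < q) (h1 : q < 1) (k l : ℕ) :
    ((1 - q) * (k : ℝ) ^ 2) ^ k * elemSymm (weight q) k l ≤ 54 ^ k := by
  have hq : 0 < 1 - q := sub_pos.2 h1
  refine (pow_mul_elemSymm_le (weight_nonneg h0 h1) (by positivity) k l).trans
    (le_trans (prod_le_prod (fun i _ => ?_) fun i _ => ?_) (prod_one_add_sq_div_le k l))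
  · have := weight_nonneg h0 h1 i
    positivity
  · gcongr
    refine (mul_le_mul_of_nonneg_left (weight_le h0 h1 i) (by positivity)).trans_eq ?_
    field_simp

/-- The `q`-factorial `(1 - q) (1 - q ^ 2) ⋯ (1 - q ^ k)`. -/
noncomputable def qPoch (q : ℝ) (k : ℕ) : ℝ := ∏ i ∈ range k, (1 - q ^ (i + 1))

theorem qPoch_pos {q : ℝ} (h0 : 0 < q) (h1 : q < 1) (k : ℕ) : 0 < qPoch q k :=
  prod_pos fun i _ => one_sub_pow_pos h0 h1 i

/-- Induction on `l`: for l ≥ k the denominator of `weight q l` is at least its value at k, and with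
that replacement the increment of the bound in degree k+1 matches the recursion exactly. -/
theorem elemSymm_weight_le_qDesc {q : ℝ} (h0 : 0 < q) (h1 : q < 1) (k l : ℕ) :
    elemSymm (weight q) k l ≤ (1 - q) ^ (k + 1) * q ^ (k * (k + 1) / 2) /
      (qPoch q k ^ 2 * qPoch q (k + 1)) * qDesc q k l := by
  have hq : 0 < 1 - q := sub_pos.2 h1
  induction l generalizing k with
  | zero =>
    cases k with
    | zero => simp [elemSymm, qPoch, qDesc, hq.ne']
    | succ k => simp [elemSymm, qDesc_eq_zero]
  | succ l ih =>
    cases k with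
    | zero => simp [elemSymm, qPoch, qDesc, hq.ne']
    | succ k =>
      rw [elemSymm]
      refine (add_le_add (ih (k + 1))
        (mul_le_mul_of_nonneg_left (ih k) (weight_nonneg h0 h1 l))).trans ?_
      rw [← le_sub_iff_add_le', ← mul_sub, qDesc_sub]
      rcases lt_or_ge l k with h | h
      · simp [qDesc_eq_zero q h]
      · have e : (k + 1) * (k + 1 + 1) / 2 = k * (k + 1) / 2 + (k + 1) := by
          rw [show (k + 1) * (k + 1 + 1) = k * (k + 1) + 2 * (k + 1) by ring,
            Nat.add_mul_div_left _ _ two_pos]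
        have hP := qPoch_pos h0 h1 k
        have hP1 := qPoch_pos h0 h1 (k + 1)
        have hl := (one_sub_pow_pos h0 h1 l).le
        have hk1 := one_sub_pow_pos h0 h1 k
        have hk2 := one_sub_pow_pos h0 h1 (k + 1)
        have e1 : qPoch q (k + 1) = qPoch q k * (1 - q ^ (k + 1)) := prod_range_succ _ _
        have e2 : qPoch q (k + 1 + 1) = qPoch q (k + 1) * (1 - q ^ (k + 1 + 1)) :=
          prod_range_succ _ _
        have hw : weight q l ≤
            (1 - q) * q ^ (l + 1) / ((1 - q ^ (k + 1)) * (1 - q ^ (k + 1 + 1))) := by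
          rw [weight]
          have h3 : q ^ (l + 1) ≤ q ^ (k + 1) := pow_le_pow_of_le_one h0.le h1.le (by omega)
          have h4 : q ^ (l + 2) ≤ q ^ (k + 1 + 1) := pow_le_pow_of_le_one h0.le h1.le (by omega)
          gcongr
        have hD := qDesc_nonneg h0 h1 k l
        refine (mul_le_mul_of_nonneg_right hw (by positivity)).trans_eq ?_
        rw [e2, e1, e, pow_add q _ (k + 1), pow_succ (1 - q) (k + 1)]
        obtain ⟨d, rfl⟩ := Nat.exists_eq_add_of_le h
        rw [Nat.add_sub_cancel_left, add_assoc k d 1, add_comm d 1, ← add_assoc, pow_add q (k + 1)]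
        have := hk1.ne'
        have := hk2.ne'
        have := hP.ne'
        field_simp

/-- Bernoulli gives q^i ≤ 1/(1+i(1-q)), which is at most M/(M+i). -/
theorem one_sub_pow_ge {q : ℝ} (h0 : 0 < q) (h1 : q < 1) {M : ℕ} (hM : 1 / (1 - q) ≤ M)
    (i : ℕ) : (i : ℝ) ≤ (i + M) * (1 - q ^ i) := by
  have hq : 0 < 1 - q := sub_pos.2 h1
  have hb := one_add_mul_le_pow (show (-2 : ℝ) ≤ 1 - q by linarith) i
  have hp : (1 + (1 - q)) ^ i * q ^ i ≤ 1 := by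
    rw [← mul_pow]
    exact pow_le_one₀ (by nlinarith) (by nlinarith [sq_nonneg (1 - q)])
  have hx := pow_pos h0 i
  rw [div_le_iff₀ hq] at hM
  have h2 : (1 + i * (1 - q)) * q ^ i ≤ 1 := (mul_le_mul_of_nonneg_right hb hx.le).trans hp
  have hi : (0 : ℝ) ≤ i := Nat.cast_nonneg i
  have hM0 : (0 : ℝ) ≤ M := Nat.cast_nonneg M
  nlinarith [mul_le_mul_of_nonneg_left hM (mul_nonneg hi hx.le),
    mul_le_mul_of_nonneg_left h2 hM0]

theorem one_le_two_pow_mul_qPoch {q : ℝ} (h0 : 0 < q) (h1 : q < 1) {M : ℕ}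
    (hM : 1 / (1 - q) ≤ M) (k : ℕ) : 1 ≤ 2 ^ (k + M) * qPoch q k := by
  -- The factors of `qPoch` are at least i/(i+M), and the product of these is the inverse of a
  -- binomial coefficient.
  have h : 1 ≤ ((k + M).choose k : ℝ) * qPoch q k := by
    induction k with
    | zero => simp [qPoch]
    | succ k ih =>
      have e1 : qPoch q (k + 1) = qPoch q k * (1 - q ^ (k + 1)) := prod_range_succ _ _
      have e2 : ((k : ℝ) + M + 1) * ((k + M).choose k) =
          ((k + 1 + M).choose (k + 1)) * (k + 1) := by
        have := Nat.add_one_mul_choose_eq (k + M) k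
        rw [show k + 1 + M = k + M + 1 by ring]
        exact_mod_cast this
      have h2 := one_sub_pow_ge h0 h1 hM (k + 1)
      push_cast at h2
      have hk : (0 : ℝ) < k + 1 := by positivity
      have h3 : ((k : ℝ) + 1) * 1 ≤
          (k + 1) * (((k + 1 + M).choose (k + 1)) * qPoch q (k + 1)) := by
        calc ((k : ℝ) + 1) * 1 ≤
            ((k + 1 + M) * (1 - q ^ (k + 1))) * (((k + M).choose k) * qPoch q k) := by
              gcongr
              exact hk.le.trans h2
          _ = _ := by
              rw [e1]
              linear_combination (qPoch q k * (1 - q ^ (k + 1))) * e2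
      exact le_of_mul_le_mul_left h3 hk
  refine h.trans (mul_le_mul_of_nonneg_right ?_ (qPoch_pos h0 h1 k).le)
  exact_mod_cast Nat.choose_le_two_pow _ _

/-- The bound on the mean count that is effective for short subsequences. -/
theorem meanCount_le_of_short {q : ℝ} (h0 : 0 < q) (h1 : q < 1) (n : ℕ) {L : ℕ} (hL : 2 ≤ L) :
    meanCount q L n ≤ n * (864 / ((1 - q) * (L : ℝ) ^ 2)) ^ L := by
  have hq : 0 < 1 - q := sub_pos.2 h1
  obtain ⟨k, rfl⟩ : ∃ k, L = k + 1 := ⟨L - 1, by omega⟩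
  have hk : (1 : ℝ) ≤ k := by exact_mod_cast (by omega : 1 ≤ k)
  refine (meanCount_le h0 h1 k n).trans ?_
  have h := elemSymm_weight_le h0 h1 k n
  have hL2 : ((k : ℝ) + 1) ^ 2 ≤ 4 * k ^ 2 := by nlinarith
  -- The polynomial has degree k = L-1, so one more factor (1-q)L^2 must be absorbed. Together with
  -- (k+1)^2 ≤ 4k^2 this costs 4·4, whence 864 = 54·16.
  have hL4 : ((k : ℝ) + 1) ^ 2 ≤ 4 ^ (k + 1) := by
    have : ((k + 1 : ℕ) : ℝ) ≤ 2 ^ (k + 1) := by exact_mod_cast (k + 1).lt_two_pow_self.le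
    push_cast at this
    calc ((k : ℝ) + 1) ^ 2 ≤ (2 ^ (k + 1)) ^ 2 := by gcongr
      _ = 4 ^ (k + 1) := by rw [← pow_mul, mul_comm, pow_mul]; norm_num
  push_cast
  rw [div_mul_eq_mul_div, mul_div_assoc]
  refine mul_le_mul_of_nonneg_left ?_ (Nat.cast_nonneg n)
  rw [div_pow, div_le_div_iff₀ hq (by positivity)]
  have he := elemSymm_nonneg (weight_nonneg h0 h1) k n
  calc elemSymm (weight q) k n * ((1 - q) * ((k : ℝ) + 1) ^ 2) ^ (k + 1)
      = elemSymm (weight q) k n * ((1 - q) ^ k * (((k : ℝ) + 1) ^ 2) ^ k) *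
        ((k + 1) ^ 2 * (1 - q)) := by rw [pow_succ _ k, mul_pow]; ring
    _ ≤ elemSymm (weight q) k n * ((1 - q) ^ k * (4 * (k : ℝ) ^ 2) ^ k) *
        (4 ^ (k + 1) * (1 - q)) := by gcongr
    _ = (((1 - q) * (k : ℝ) ^ 2) ^ k * elemSymm (weight q) k n) *
        (4 ^ k * 4 ^ (k + 1) * (1 - q)) := by rw [mul_pow 4, mul_pow (1 - q)]; ring
    _ ≤ 54 ^ k * (4 ^ k * 4 ^ (k + 1) * (1 - q)) := by gcongr
    _ ≤ 864 ^ (k + 1) * (1 - q) := by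
        rw [← mul_assoc]
        refine mul_le_mul_of_nonneg_right ?_ hq.le
        calc (54 : ℝ) ^ k * (4 ^ k * 4 ^ (k + 1)) = 4 * 864 ^ k := by
              rw [pow_succ, ← mul_assoc, ← mul_assoc, ← mul_pow, ← mul_pow, mul_comm]
              norm_num
          _ ≤ 864 ^ (k + 1) := by
              rw [pow_succ, mul_comm]
              gcongr
              norm_num

/-- The bound on the mean count that is effective for long subsequences. -/
theorem meanCount_le_of_long {q : ℝ} (h0 : 0 < q) (h1 : q < 1) (n : ℕ) {L : ℕ} (hL : 1 ≤ L)
    (hM : ⌈1 / (1 - q)⌉₊ ≤ L) :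
    meanCount q L n ≤ n / (1 - q) * ((64 * (1 - q)) ^ L * q ^ (L * (L - 1) / 2)) := by
  have hq : 0 < 1 - q := sub_pos.2 h1
  obtain ⟨k, rfl⟩ : ∃ k, L = k + 1 := ⟨L - 1, by omega⟩
  refine (meanCount_le h0 h1 k n).trans (mul_le_mul_of_nonneg_left ?_ (by positivity))
  have hP := qPoch_pos h0 h1 k
  have hP1 := qPoch_pos h0 h1 (k + 1)
  have hM' : 1 / (1 - q) ≤ ((k + 1 : ℕ) : ℝ) := (Nat.le_ceil _).trans (by exact_mod_cast hM)
  have hk : 1 ≤ 4 ^ (k + 1) * qPoch q k := by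
    refine (one_le_two_pow_mul_qPoch h0 h1 hM' k).trans ?_
    have : (2 : ℝ) ^ (k + (k + 1)) ≤ 4 ^ (k + 1) := by
      rw [show (4 : ℝ) = 2 ^ 2 by norm_num, ← pow_mul]
      exact pow_le_pow_right₀ one_le_two (by omega)
    gcongr
  have hk1 : 1 ≤ 4 ^ (k + 1) * qPoch q (k + 1) := by
    refine (one_le_two_pow_mul_qPoch h0 h1 hM' (k + 1)).trans_eq ?_
    rw [show (4 : ℝ) = 2 ^ 2 by norm_num, ← pow_mul]
    congr 2
    ring
  have hD : 0 ≤ (1 - q) ^ (k + 1) * q ^ (k * (k + 1) / 2) := by positivity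
  refine (elemSymm_weight_le_qDesc h0 h1 k n).trans ((mul_le_of_le_one_right (by positivity)
    (qDesc_le_one h0 h1 k n)).trans ?_)
  rw [div_le_iff₀ (by positivity), Nat.add_sub_cancel, mul_comm (k + 1) k]
  calc (1 - q) ^ (k + 1) * q ^ (k * (k + 1) / 2)
      ≤ (1 - q) ^ (k + 1) * q ^ (k * (k + 1) / 2) *
        ((4 ^ (k + 1) * qPoch q k) ^ 2 * (4 ^ (k + 1) * qPoch q (k + 1))) :=
        le_mul_of_one_le_right hD (one_le_mul_of_one_le_of_one_le (one_le_pow₀ hk) hk1)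
    _ = _ := by
        have e : (64 : ℝ) ^ (k + 1) = (4 ^ (k + 1)) ^ 3 := by
          rw [← pow_mul, mul_comm, pow_mul]
          norm_num
        rw [mul_pow 64, e]
        ring

/-! ### Independence of the patterns on disjoint intervals of positions -/

/-- The permutation of `Fin (a + b)` mapping the first `a` positions to the set `A` with pattern
`τ₁` and the last `b` positions to the complement of `A` with pattern `τ₂`. -/
def combine {a b : ℕ} (A : {A : Finset (Fin (a + b)) // A.card = a ∧ Aᶜ.card = b})
    (τ₁ : Equiv.Perm (Fin a)) (τ₂ : Equiv.Perm (Fin b)) : Equiv.Perm (Fin (a + b)) :=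
  finSumFinEquiv.symm.trans ((Equiv.sumCongr τ₁ τ₂).trans (finSumEquivOfFinset A.2.1 A.2.2))

section Combine

variable {a b : ℕ} (A : {A : Finset (Fin (a + b)) // A.card = a ∧ Aᶜ.card = b})
  (τ₁ : Equiv.Perm (Fin a)) (τ₂ : Equiv.Perm (Fin b))

theorem combine_castAdd (i : Fin a) :
    combine A τ₁ τ₂ (Fin.castAdd b i) = A.1.orderEmbOfFin A.2.1 (τ₁ i) := by
  simp [combine]

theorem combine_natAdd (i : Fin b) :
    combine A τ₁ τ₂ (Fin.natAdd a i) = A.1ᶜ.orderEmbOfFin A.2.2 (τ₂ i) := by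
  simp [combine]

end Combine

theorem combine_bijective (a b : ℕ) :
    Function.Bijective fun p : {A : Finset (Fin (a + b)) // A.card = a ∧ Aᶜ.card = b} ×
      Equiv.Perm (Fin a) × Equiv.Perm (Fin b) => combine p.1 p.2.1 p.2.2 := by
  rw [Fintype.bijective_iff_injective_and_card]
  constructor
  · rintro ⟨A, τ₁, τ₂⟩ ⟨A', τ₁', τ₂'⟩ h
    have h1 : ∀ i, A.1.orderEmbOfFin A.2.1 (τ₁ i) = A'.1.orderEmbOfFin A'.2.1 (τ₁' i) := fun i => by
      rw [← combine_castAdd A τ₁ τ₂, ← combine_castAdd A' τ₁' τ₂']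
      exact congrArg (fun σ => σ (Fin.castAdd b i)) h
    have h2 : ∀ i, A.1ᶜ.orderEmbOfFin A.2.2 (τ₂ i) = A'.1ᶜ.orderEmbOfFin A'.2.2 (τ₂' i) :=
      fun i => by
        rw [← combine_natAdd A τ₁ τ₂, ← combine_natAdd A' τ₁' τ₂']
        exact congrArg (fun σ => σ (Fin.natAdd a i)) h
    have hA : A = A' := by
      refine Subtype.ext (eq_of_subset_of_card_le (fun x hx => ?_) (by rw [A.2.1, A'.2.1]))
      rw [← mem_coe, ← range_orderEmbOfFin A.1 A.2.1] at hx
      obtain ⟨i, rfl⟩ := hx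
      rw [← τ₁.apply_symm_apply i, h1]
      exact orderEmbOfFin_mem _ _ _
    subst hA
    refine Prod.ext rfl (Prod.ext (Equiv.ext fun i => ?_) (Equiv.ext fun i => ?_))
    · exact (A.1.orderEmbOfFin A.2.1).injective (h1 i)
    · exact (A.1ᶜ.orderEmbOfFin A.2.2).injective (h2 i)
  · have : Fintype.card {A : Finset (Fin (a + b)) // A.card = a ∧ Aᶜ.card = b} =
        (a + b).choose a := by
      rw [Fintype.card_subtype]
      have : (univ.filter fun A : Finset (Fin (a + b)) => A.card = a ∧ Aᶜ.card = b) =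
          powersetCard a univ := by
        ext A
        simp only [mem_filter, mem_univ, true_and, mem_powersetCard, subset_univ, card_compl,
          Fintype.card_fin]
        omega
      rw [this, card_powersetCard, card_univ, Fintype.card_fin]
    simp only [Fintype.card_prod, this, Fintype.card_perm, Fintype.card_fin]
    rw [← mul_assoc, Nat.choose_symm_add, Nat.add_choose_mul_factorial_mul_factorial]

theorem inversions_combine {a b : ℕ}
    (A : {A : Finset (Fin (a + b)) // A.card = a ∧ Aᶜ.card = b})
    (τ₁ : Equiv.Perm (Fin a)) (τ₂ : Equiv.Perm (Fin b)) :
    inversions (combine A τ₁ τ₂) = (∑ i, ∑ j,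
      if A.1ᶜ.orderEmbOfFin A.2.2 j < A.1.orderEmbOfFin A.2.1 i then 1 else 0) +
      (inversions τ₁ + inversions τ₂) := by
  have h1 : ∀ (i : Fin a) (j : Fin b), Fin.castAdd b i < Fin.natAdd a j := fun i j => by
    simp only [Fin.lt_def, Fin.val_castAdd, Fin.val_natAdd]
    omega
  have h2 : (∑ i, ∑ j,
      if A.1ᶜ.orderEmbOfFin A.2.2 j < A.1.orderEmbOfFin A.2.1 i then 1 else 0) = ∑ i, ∑ j,
      if A.1ᶜ.orderEmbOfFin A.2.2 (τ₂ j) < A.1.orderEmbOfFin A.2.1 (τ₁ i) then 1 else 0 := by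
    rw [← Equiv.sum_comp τ₁]
    exact sum_congr rfl fun i _ => (Equiv.sum_comp τ₂ _).symm
  rw [h2]
  simp only [inversions_eq_sum, Fin.sum_univ_add, combine_castAdd, combine_natAdd, h1,
    (h1 _ _).not_gt, sum_add_distrib]
  simp only [OrderEmbedding.lt_iff_lt, true_and, false_and, if_false, sum_const_zero,
    (Fin.strictMono_castAdd b).lt_iff_lt, (Fin.strictMono_natAdd a).lt_iff_lt]
  ring

/-- The patterns of a Mallows permutation on two complementary intervals of positions are
independent Mallows permutations. -/
theorem expect_combine {a b : ℕ} {q : ℝ} (hq : 0 < q) {F : Equiv.Perm (Fin (a + b)) → ℝ}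
    {f : Equiv.Perm (Fin a) → ℝ} {g : Equiv.Perm (Fin b) → ℝ}
    (h : ∀ A τ₁ τ₂, F (combine A τ₁ τ₂) = f τ₁ * g τ₂) :
    expect (a + b) q F = expect a q f * expect b q g := by
  obtain ⟨K, hK⟩ : ∃ K : ℝ, ∀ (F : Equiv.Perm (Fin (a + b)) → ℝ)
      (f : Equiv.Perm (Fin a) → ℝ) (g : Equiv.Perm (Fin b) → ℝ),
      (∀ A τ₁ τ₂, F (combine A τ₁ τ₂) = f τ₁ * g τ₂) → ∑ σ, q ^ inversions σ * F σ =
        K * ((∑ τ, q ^ inversions τ * f τ) * ∑ τ, q ^ inversions τ * g τ) := by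
    -- Only inversions between the two intervals depend on `A`, and they do not depend on the
    -- patterns, so their weight factors out as `K`.
    refine ⟨∑ A : {A : Finset (Fin (a + b)) // A.card = a ∧ Aᶜ.card = b}, q ^ (∑ i, ∑ j,
      if A.1ᶜ.orderEmbOfFin A.2.2 j < A.1.orderEmbOfFin A.2.1 i then 1 else 0),
      fun F f g h => ?_⟩
    rw [← (combine_bijective a b).sum_comp (fun σ => q ^ inversions σ * F σ),
      Fintype.sum_prod_type, sum_mul]
    refine sum_congr rfl fun A _ => ?_
    rw [Fintype.sum_prod_type, sum_mul_sum, mul_sum]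
    refine sum_congr rfl fun τ₁ _ => ?_
    rw [mul_sum]
    refine sum_congr rfl fun τ₂ _ => ?_
    rw [inversions_combine, h, pow_add, pow_add]
    ring
  have hZ : partitionFunction (a + b) q =
      K * (partitionFunction a q * partitionFunction b q) := by
    simpa [partitionFunction] using hK (fun _ => 1) (fun _ => 1) (fun _ => 1) (by simp)
  have h0 := partitionFunction_pos (a + b) hq
  have hK0 : K ≠ 0 := by
    rintro rfl
    simp [hZ] at h0
  rw [expect_eq_div, expect_eq_div, expect_eq_div, hK F f g h, hZ, mul_div_mul_left _ _ hK0,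
    div_mul_div_comm]

theorem prob_nonneg (n : ℕ) {q : ℝ} (hq : 0 < q) (E : Set (Equiv.Perm (Fin n))) :
    0 ≤ prob n q E :=
  sum_nonneg fun σ _ => Set.indicator_nonneg (fun σ _ => mass_nonneg n hq σ) σ

theorem prob_mono (n : ℕ) {q : ℝ} (hq : 0 < q) {E F : Set (Equiv.Perm (Fin n))} (h : E ⊆ F) :
    prob n q E ≤ prob n q F :=
  sum_le_sum fun σ _ => Set.indicator_le_indicator_of_subset h (fun σ => mass_nonneg n hq σ) σ

theorem prob_le_one (n : ℕ) {q : ℝ} (hq : 0 < q) (E : Set (Equiv.Perm (Fin n))) :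
    prob n q E ≤ 1 :=
  (prob_mono n hq (Set.subset_univ E)).trans_eq (prob_univ n hq)

theorem prob_compl (n : ℕ) {q : ℝ} (hq : 0 < q) (E : Set (Equiv.Perm (Fin n))) :
    prob n q E = 1 - prob n q Eᶜ := by
  rw [eq_sub_iff_add_eq, ← prob_univ n hq]
  simp only [prob, ← sum_add_distrib, Set.indicator_univ]
  exact sum_congr rfl fun σ _ => congrFun (Set.indicator_self_add_compl E (mass n q)) σ

theorem prob_le_LDS (n : ℕ) {q : ℝ} (hq : 0 < q) (L : ℕ) :
    prob n q {σ | L ≤ LDS σ} = 1 - prob n q {σ | LDS σ < L} := by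
  rw [prob_compl n hq]
  congr 3
  ext σ
  simp

theorem LDS_le_combine_left {a b : ℕ}
    (A : {A : Finset (Fin (a + b)) // A.card = a ∧ Aᶜ.card = b})
    (τ₁ : Equiv.Perm (Fin a)) (τ₂ : Equiv.Perm (Fin b)) : LDS τ₁ ≤ LDS (combine A τ₁ τ₂) := by
  obtain ⟨⟨i, hi, hi'⟩, -⟩ := isGreatest_LDS τ₁
  refine (isGreatest_LDS _).2 ⟨fun k => Fin.castAdd b (i k),
    (Fin.strictMono_castAdd b).comp hi, fun x y hxy => ?_⟩
  simp only [combine_castAdd, OrderEmbedding.lt_iff_lt]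
  exact hi' hxy

theorem LDS_le_combine_right {a b : ℕ}
    (A : {A : Finset (Fin (a + b)) // A.card = a ∧ Aᶜ.card = b})
    (τ₁ : Equiv.Perm (Fin a)) (τ₂ : Equiv.Perm (Fin b)) : LDS τ₂ ≤ LDS (combine A τ₁ τ₂) := by
  obtain ⟨⟨i, hi, hi'⟩, -⟩ := isGreatest_LDS τ₂
  refine (isGreatest_LDS _).2 ⟨fun k => Fin.natAdd a (i k),
    (Fin.strictMono_natAdd a).comp hi, fun x y hxy => ?_⟩
  simp only [combine_natAdd, OrderEmbedding.lt_iff_lt]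
  exact hi' hxy

/-- If the whole permutation has short decreasing subsequences then so do both patterns, and these
are independent. -/
theorem prob_LDS_lt_add_le (a b : ℕ) {q : ℝ} (hq : 0 < q) (L : ℕ) :
    prob (a + b) q {σ | LDS σ < L} ≤ prob a q {σ | LDS σ < L} * prob b q {σ | LDS σ < L} := by
  classical
  let e := (Equiv.ofBijective _ (combine_bijective a b)).symm
  have he : ∀ A τ₁ τ₂, e (combine A τ₁ τ₂) = (A, τ₁, τ₂) := fun A τ₁ τ₂ =>
    Equiv.ofBijective_symm_apply_apply _ (combine_bijective a b) (A, τ₁, τ₂)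
  have hs : ∀ σ, combine (e σ).1 (e σ).2.1 (e σ).2.2 = σ := fun σ =>
    Equiv.ofBijective_apply_symm_apply _ (combine_bijective a b) σ
  simp only [prob_eq_expect]
  rw [← expect_combine hq (F := fun σ =>
    ({σ | LDS σ < L} : Set (Equiv.Perm (Fin a))).indicator 1 (e σ).2.1 *
      ({σ | LDS σ < L} : Set (Equiv.Perm (Fin b))).indicator 1 (e σ).2.2)
    (fun A τ₁ τ₂ => by rw [he])]
  refine expect_mono _ hq fun σ => ?_
  by_cases h : LDS σ < L
  · rw [← hs σ] at h
    have h1 := (LDS_le_combine_left _ _ _).trans_lt h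
    have h2 := (LDS_le_combine_right _ _ _).trans_lt h
    rw [Set.indicator_of_mem (a := (e σ).2.1) (by exact h1),
      Set.indicator_of_mem (a := (e σ).2.2) (by exact h2)]
    exact (Set.indicator_le_self' (fun _ _ => zero_le_one) σ).trans (by simp)
  · rw [Set.indicator_of_notMem (by exact h)]
    exact mul_nonneg (Set.indicator_nonneg (fun _ _ => zero_le_one) _)
      (Set.indicator_nonneg (fun _ _ => zero_le_one) _)

theorem prob_LDS_lt_antitone {q : ℝ} (hq : 0 < q) (L : ℕ) :
    Antitone fun n => prob n q {σ | LDS σ < L} := by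
  refine antitone_nat_of_succ_le fun n => ?_
  exact (prob_LDS_lt_add_le n 1 hq L).trans
    (mul_le_of_le_one_right (prob_nonneg n hq _) (prob_le_one 1 hq _))

theorem prob_LDS_lt_le_pow {q : ℝ} (hq : 0 < q) (L : ℕ) {m b n : ℕ} (h : b * m ≤ n) :
    prob n q {σ | LDS σ < L} ≤ prob m q {σ | LDS σ < L} ^ b := by
  refine (prob_LDS_lt_antitone hq L h).trans ?_
  clear h
  induction b with
  | zero => simpa using prob_le_one _ hq _
  | succ b ih =>
    rw [pow_succ, Nat.succ_mul]
    exact (prob_LDS_lt_add_le (b * m) m hq L).trans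
      (mul_le_mul_of_nonneg_right ih (prob_nonneg m hq _))

/-- Lower bounds for a block of length `m` are amplified by independence of disjoint blocks. -/
theorem le_prob_le_LDS_of_block {q : ℝ} (hq : 0 < q) {L m b n : ℕ} (h : b * m ≤ n) {x : ℝ}
    (hx : x ≤ prob m q {σ | L ≤ LDS σ}) :
    1 - (1 - x) ^ b ≤ prob n q {σ | L ≤ LDS σ} := by
  rw [prob_le_LDS n hq]
  rw [prob_le_LDS m hq] at hx
  refine sub_le_sub_left ((prob_LDS_lt_le_pow hq L h).trans ?_) 1
  exact pow_le_pow_left₀ (prob_nonneg m hq _) (by linarith) b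

/-! ### Lower bounds by greedy exploration -/

theorem prob_le_LDS_eq_expect (n : ℕ) (q : ℝ) (L : ℕ) :
    prob n q {σ | L ≤ LDS σ} =
      expect n q fun σ => if 0 < (decSets L n σ).card then 1 else 0 := by
  rw [prob_eq_expect]
  congr 1
  funext σ
  by_cases h : L ≤ LDS σ
  · rw [Set.indicator_of_mem (by exact h), if_pos (le_LDS_iff.1 h)]
    rfl
  · rw [Set.indicator_of_notMem (by exact h), if_neg (fun h' => h (le_LDS_iff.2 h'))]

theorem prob_le_LDS_monotone {q : ℝ} (hq : 0 < q) (L : ℕ) :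
    Monotone fun n => prob n q {σ | L ≤ LDS σ} := fun m n h => by
  simp only [prob_le_LDS _ hq]
  exact sub_le_sub_left (prob_LDS_lt_antitone hq L h) 1

/-- One step of the exploration: either the first position continues a decreasing subsequence
with a value among the `w` largest ones, or it is discarded. -/
theorem le_prob_le_LDS_succ {q : ℝ} (h0 : 0 < q) (h1 : q < 1) {k n w : ℕ} (hw : w ≤ n + 1)
    {x s p : ℝ} (hx0 : 0 ≤ x) (hs : s ≤ 1)
    (hx : x ≤ prob (n + 1 - w) q {σ | k ≤ LDS σ})
    (hy : s * x ≤ prob n q {σ | k + 1 ≤ LDS σ}) (hp : p ≤ w * q ^ n * (1 - q)) :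
    (1 - (1 - p) * (1 - s)) * x ≤ prob (n + 1) q {σ | k + 1 ≤ LDS σ} := by
  have hq : 0 < 1 - q := sub_pos.2 h1
  -- A first value `j` among the `w` largest leaves at least n+1-w values below it, enough to find
  -- `k` more terms with probability `x`; otherwise the first position is dropped and `hy` applies.
  have hE : ∀ j : Fin (n + 1), s * x + (1 - s) * x * (if n + 1 - w ≤ (j : ℕ) then 1 else 0) ≤
      expect n q (fun τ =>
        if 0 < (decSets (k + 1) (n + 1) (insertAt 0 j τ)).card then 1 else 0) := fun j => by
    simp only [card_decSets_insertAt_zero]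
    split_ifs with hj
    · have e : s * x + (1 - s) * x * 1 = x := by ring
      rw [e]
      refine hx.trans ((prob_le_LDS_monotone h0 k hj).trans ?_)
      simp only [prob_le_LDS_eq_expect]
      rw [← expect_card_decSets_of_le h0 (Nat.lt_succ_iff.1 j.2) k
        (fun m => if 0 < m then (1 : ℝ) else 0)]
      refine expect_mono n h0 fun τ => ?_
      split_ifs <;> first | omega | norm_num
    · rw [mul_zero, add_zero]
      refine hy.trans ?_
      rw [prob_le_LDS_eq_expect]
      refine expect_mono n h0 fun τ => ?_
      split_ifs <;> first | omega | norm_num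
  rw [prob_le_LDS_eq_expect, expect_succ, le_div_iff₀ (geom_pos h0 n)]
  refine le_trans ?_ (sum_le_sum fun j _ =>
    mul_le_mul_of_nonneg_left (hE j) (pow_nonneg h0.le (j : ℕ)))
  rw [Fin.sum_univ_eq_sum_range (fun j => q ^ j *
    (s * x + (1 - s) * x * (if n + 1 - w ≤ j then 1 else 0)))]
  set G := ∑ j ∈ range (n + 1), q ^ j with hG
  have hG1 : G * (1 - q) ≤ 1 := by
    rw [hG, geom_sum_mul_neg]
    exact sub_le_self _ (pow_nonneg h0.le _)
  have hG0 : 0 < G := geom_pos h0 n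
  have hT : (w : ℝ) * q ^ n ≤
      ∑ j ∈ range (n + 1), q ^ j * (if n + 1 - w ≤ j then 1 else 0) := by
    have hsub : Ico (n + 1 - w) (n + 1) ⊆ range (n + 1) := fun j hj => by
      simp only [mem_Ico, mem_range] at hj ⊢
      omega
    refine le_trans ?_ (sum_le_sum_of_subset_of_nonneg hsub fun j _ _ => by positivity)
    have : ((Ico (n + 1 - w) (n + 1)).card : ℝ) = w := by
      rw [Nat.card_Ico]
      congr 1
      omega
    rw [← this, ← nsmul_eq_mul]
    refine card_nsmul_le_sum _ _ _ fun j hj => ?_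
    rw [mem_Ico] at hj
    rw [if_pos hj.1, mul_one]
    exact pow_le_pow_of_le_one h0.le h1.le (by omega)
  have e : ∑ j ∈ range (n + 1), q ^ j *
      (s * x + (1 - s) * x * (if n + 1 - w ≤ j then 1 else 0)) = G * (s * x) +
      (1 - s) * x * ∑ j ∈ range (n + 1), q ^ j * (if n + 1 - w ≤ j then 1 else 0) := by
    rw [hG, sum_mul, mul_sum, ← sum_add_distrib]
    exact sum_congr rfl fun j _ => by ring
  rw [e]
  have hsx : 0 ≤ (1 - s) * x := mul_nonneg (sub_nonneg.2 hs) hx0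
  have hwq : (0 : ℝ) ≤ w * q ^ n := by positivity
  have h2 : p * G ≤ w * q ^ n := calc
    p * G ≤ w * q ^ n * (1 - q) * G := mul_le_mul_of_nonneg_right hp hG0.le
    _ = w * q ^ n * (G * (1 - q)) := by ring
    _ ≤ w * q ^ n := mul_le_of_le_one_right hwq hG1
  have h3 := mul_le_mul_of_nonneg_left (h2.trans hT) hsx
  nlinarith

theorem le_prob_le_LDS_self {q : ℝ} (h0 : 0 < q) (h1 : q < 1) (L : ℕ) :
    q ^ (L * (L - 1) / 2) * (1 - q) ^ L ≤ prob L q {σ | L ≤ LDS σ} := by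
  induction L with
  | zero => simp [prob_univ 0 h0]
  | succ k ih =>
    have hq : 0 < 1 - q := sub_pos.2 h1
    -- For a full reversal the first value must be the largest, hence `w = 1`, and no position may
    -- be dropped, hence `s = 0`.
    have h := le_prob_le_LDS_succ h0 h1 (k := k) (n := k) (w := 1) (s := 0)
      (p := q ^ k * (1 - q)) (by omega) (by positivity) zero_le_one ih
      (by simpa using prob_nonneg k h0 _) (by simp)
    refine le_trans (le_of_eq ?_) h
    rw [Nat.triangle_succ, pow_add]
    ring

/-- One stage with `d` attempts: at least `N` values remain below the accepted one, whichever
attempt succeeds, and all attempts fail with probability bounded by `(1 - p) ^ d`. -/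
theorem le_prob_le_LDS_add {q : ℝ} (h0 : 0 < q) (h1 : q < 1) {k N w : ℕ} {p : ℝ} (hp1 : p ≤ 1)
    (d : ℕ) (hp : p ≤ w * q ^ (N + w + d) * (1 - q)) :
    (1 - (1 - p) ^ d) * prob N q {σ | k ≤ LDS σ} ≤
      prob (N + w + d) q {σ | k + 1 ≤ LDS σ} := by
  have hq : 0 < 1 - q := sub_pos.2 h1
  induction d with
  | zero => simpa using prob_nonneg _ h0 _
  | succ d ih =>
    have hp' : p ≤ w * q ^ (N + w + d) * (1 - q) := by
      refine hp.trans ?_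
      have := pow_le_pow_of_le_one h0.le h1.le (Nat.le_succ (N + w + d))
      exact mul_le_mul_of_nonneg_right (mul_le_mul_of_nonneg_left this (by positivity)) hq.le
    have h := le_prob_le_LDS_succ h0 h1 (k := k) (n := N + w + d) (w := w)
      (s := 1 - (1 - p) ^ d) (by omega) (prob_nonneg N h0 _)
      (sub_le_self _ (pow_nonneg (sub_nonneg.2 hp1) d))
      (prob_le_LDS_monotone h0 k (by omega : N ≤ N + w + d + 1 - w)) (ih hp') hp'
    refine le_trans (le_of_eq ?_) h
    ring

/-- `L` stages with windows of `d` values and `d` attempts use length 2d each, hence the condition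
on `m`. -/
theorem pow_le_prob_le_LDS {q : ℝ} (h0 : 0 < q) (h1 : q < 1) {d m : ℕ} {p : ℝ} (hp0 : 0 ≤ p)
    (hp1 : p ≤ 1) (hp : p ≤ d * q ^ m * (1 - q)) (L : ℕ) (hL : 2 * d * L ≤ m) :
    (1 - (1 - p) ^ d) ^ L ≤ prob m q {σ | L ≤ LDS σ} := by
  have hq : 0 < 1 - q := sub_pos.2 h1
  refine le_trans ?_ (prob_le_LDS_monotone h0 L hL)
  dsimp only
  induction L with
  | zero => simp [prob_univ 0 h0]
  | succ k ih =>
    have e : 2 * d * (k + 1) = 2 * d * k + d + d := by ring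
    have h := le_prob_le_LDS_add h0 h1 (k := k) (N := 2 * d * k) (w := d) hp1 d (by
      refine hp.trans ?_
      have := pow_le_pow_of_le_one h0.le h1.le (e ▸ hL)
      gcongr)
    rw [e]
    refine le_trans ?_ h
    rw [pow_succ']
    refine mul_le_mul_of_nonneg_left (ih (by rw [e] at hL; omega)) (sub_nonneg.2 ?_)
    exact pow_le_one₀ (sub_nonneg.2 hp1) (sub_le_self _ hp0)

/-! ### Counting permutations without long decreasing subsequences -/

/-- The maximal length of a decreasing subsequence ending at a given position. -/
def endLength {n : ℕ} (σ : Equiv.Perm (Fin n)) (i : Fin n) : ℕ :=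
  (univ.filter fun s : Finset (Fin n) =>
    (∀ a ∈ s, ∀ b ∈ s, a < b → σ b < σ a) ∧ i ∈ s ∧ ∀ a ∈ s, a ≤ i).sup card

theorem endLength_le_LDS {n : ℕ} (σ : Equiv.Perm (Fin n)) (i : Fin n) :
    endLength σ i ≤ LDS σ := by
  refine Finset.sup_le fun s hs => ?_
  rw [le_LDS_iff, card_pos]
  exact ⟨s, mem_decSets.2 ⟨rfl, (mem_filter.1 hs).2.1, fun a _ => Fin.is_lt _⟩⟩

theorem endLength_lt {n : ℕ} {σ : Equiv.Perm (Fin n)} {i j : Fin n} (hij : i < j)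
    (h : σ j < σ i) : endLength σ i < endLength σ j := by
  obtain ⟨s, hs, hs'⟩ := exists_mem_eq_sup (univ.filter fun s : Finset (Fin n) =>
    (∀ a ∈ s, ∀ b ∈ s, a < b → σ b < σ a) ∧ i ∈ s ∧ ∀ a ∈ s, a ≤ i) ⟨{i}, by simp⟩ card
  rw [endLength, hs', Nat.lt_iff_add_one_le]
  obtain ⟨h1, h2, h3⟩ := (mem_filter.1 hs).2
  have hj : j ∉ s := fun hj => (h3 j hj).not_gt hij
  rw [← card_cons hj]
  refine le_sup (f := card) (mem_filter.2 ⟨mem_univ _, ?_, mem_cons_self _ _, ?_⟩)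
  · intro a ha b hb hab
    rw [mem_cons] at ha hb
    rcases ha with rfl | ha <;> rcases hb with rfl | hb
    · exact absurd hab (lt_irrefl _)
    · exact absurd (hab.trans_le (h3 b hb)) hij.not_gt
    · rcases (h3 a ha).eq_or_lt with rfl | hai
      · exact h
      · exact h.trans (h1 a ha i h2 hai)
    · exact h1 a ha b hb hab
  · intro a ha
    rw [mem_cons] at ha
    rcases ha with rfl | ha
    · exact le_rfl
    · exact (h3 a ha).trans hij.le

/-- Otherwise `τ` takes the value `σ i` later than position `i`, where its label exceeds that of `i`
by `endLength_lt`; but the agreement by values and by positions makes the two labels equal. -/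
theorem not_lt_of_endLength_eq {n : ℕ} {σ τ : Equiv.Perm (Fin n)}
    (h : ∀ i, endLength σ i = endLength τ i)
    (h' : ∀ v, endLength σ (σ.symm v) = endLength τ (τ.symm v)) {i : Fin n}
    (hi : ∀ j < i, σ j = τ j) : ¬ σ i < τ i := fun hlt => by
  have hv : τ (τ.symm (σ i)) = σ i := τ.apply_symm_apply _
  have hne : τ.symm (σ i) ≠ i := fun e => by
    rw [e] at hv
    exact hlt.ne' hv
  have hge : i < τ.symm (σ i) := by
    refine lt_of_le_of_ne (not_lt.1 fun hl => ?_) hne.symm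
    have := hi _ hl
    rw [hv] at this
    exact hl.ne (σ.injective this)
  have h1 := endLength_lt hge (hv.trans_lt hlt)
  have h2 := h' (σ i)
  rw [σ.symm_apply_apply, h] at h2
  exact h1.ne h2

theorem eq_of_endLength_eq {n : ℕ} {σ τ : Equiv.Perm (Fin n)}
    (h : ∀ i, endLength σ i = endLength τ i)
    (h' : ∀ v, endLength σ (σ.symm v) = endLength τ (τ.symm v)) : σ = τ := by
  refine Equiv.ext fun i => ?_
  induction i using WellFoundedLT.induction with
  | ind i ih =>
    exact le_antisymm
      (not_lt.1 (not_lt_of_endLength_eq (fun i => (h i).symm) (fun v => (h' v).symm)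
        fun j hj => (ih j hj).symm))
      (not_lt.1 (not_lt_of_endLength_eq h h' ih))

theorem card_LDS_lt_le (n L : ℕ) :
    Nat.card {σ : Equiv.Perm (Fin n) // LDS σ < L} ≤ (L ^ 2) ^ n := by
  have hf : Function.Injective fun σ : {σ : Equiv.Perm (Fin n) // LDS σ < L} =>
      ((fun i => ⟨endLength σ.1 i, (endLength_le_LDS σ.1 i).trans_lt σ.2⟩,
        fun v => ⟨endLength σ.1 (σ.1.symm v), (endLength_le_LDS σ.1 _).trans_lt σ.2⟩) :
        (Fin n → Fin L) × (Fin n → Fin L)) := by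
    intro σ τ h
    simp only [Prod.mk.injEq, funext_iff, Fin.mk.injEq] at h
    exact Subtype.ext (eq_of_endLength_eq h.1 h.2)
  refine (Nat.card_le_card_of_injective _ hf).trans_eq ?_
  simp only [Nat.card_eq_fintype_card, Fintype.card_prod, Fintype.card_fun, Fintype.card_fin]
  ring

theorem prob_LDS_lt_le_div {q : ℝ} (h0 : 0 < q) (h1 : q < 1) (n L : ℕ) :
    prob n q {σ | LDS σ < L} ≤ ((L : ℝ) ^ 2) ^ n / partitionFunction n q := by
  classical
  have hZ := partitionFunction_pos n h0
  have h := card_LDS_lt_le n L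
  rw [Nat.card_eq_fintype_card, Fintype.card_subtype] at h
  calc prob n q {σ | LDS σ < L}
      ≤ ∑ σ : Equiv.Perm (Fin n), if LDS σ < L then 1 / partitionFunction n q else 0 := by
        refine sum_le_sum fun σ _ => ?_
        rw [Set.indicator_apply]
        simp only [Set.mem_ofPred_eq]
        split_ifs
        · exact div_le_div_of_nonneg_right (pow_le_one₀ h0.le h1.le) hZ.le
        · exact le_rfl
    _ = ((univ.filter fun σ : Equiv.Perm (Fin n) => LDS σ < L).card : ℝ) /
        partitionFunction n q := by
        rw [← sum_filter, sum_const, nsmul_eq_mul, mul_one_div]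
    _ ≤ _ := by
        refine div_le_div_of_nonneg_right ?_ hZ.le
        exact_mod_cast h

/-- The partition function is a product of geometric sums, and the one with r terms is at least r
q^m. -/
theorem factorial_mul_pow_le_partitionFunction {q : ℝ} (h0 : 0 < q) (h1 : q < 1) {m n : ℕ}
    (h : n ≤ m) : n.factorial * (q ^ m) ^ n ≤ partitionFunction n q := by
  induction n with
  | zero => simp [partitionFunction, inversions]
  | succ n ih =>
    rw [partitionFunction_succ, Nat.factorial_succ, pow_succ]
    have h2 : ((n : ℝ) + 1) * q ^ m ≤ ∑ j ∈ range (n + 1), q ^ j := by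
      have := card_nsmul_le_sum (range (n + 1)) (fun j => q ^ j) (q ^ m) fun j hj =>
        pow_le_pow_of_le_one h0.le h1.le (by rw [mem_range] at hj; omega)
      rw [card_range, nsmul_eq_mul] at this
      exact_mod_cast this
    have h3 := mul_le_mul h2 (ih (by omega)) (by positivity) (geom_pos h0 n).le
    refine le_trans (le_of_eq ?_) h3
    push_cast
    ring

/-- For q ≥ 1/2, log q ≥ 1-1/q ≥ -2(1-q), so q^m ≥ e^(-2t) ≥ 9^(-t). -/
theorem one_le_pow_mul_pow {q : ℝ} (h0 : 1 / 2 ≤ q) (h1 : q < 1) {m t : ℕ}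
    (h : m * (1 - q) ≤ t) : 1 ≤ 9 ^ t * q ^ m := by
  have hq : 0 < q := by linarith
  have h2 := Real.one_sub_inv_le_log_of_pos hq
  have h3 : -2 * (1 - q) ≤ 1 - q⁻¹ := by
    have : q⁻¹ ≤ 1 + 2 * (1 - q) := by
      rw [inv_le_iff_one_le_mul₀ hq]
      nlinarith
    linarith
  have h4 : -(2 * t : ℝ) ≤ m * Real.log q := by
    nlinarith [mul_le_mul_of_nonneg_left (h3.trans h2) (Nat.cast_nonneg m : (0 : ℝ) ≤ m)]
  have h5 : Real.exp (-(2 * t : ℕ)) ≤ q ^ m := by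
    rw [← Real.exp_log (pow_pos hq m), Real.log_pow]
    push_cast
    exact Real.exp_le_exp.2 h4
  have h6 := exp_natCast_le (2 * t)
  calc (1 : ℝ) = Real.exp (2 * t : ℕ) * Real.exp (-(2 * t : ℕ)) := by
        rw [← Real.exp_add, add_neg_cancel, Real.exp_zero]
    _ ≤ 3 ^ (2 * t) * q ^ m := by gcongr
    _ = _ := by rw [pow_mul]; norm_num

/-- By Bernoulli (1-p)^d ≤ 1/(1+dp), so the right side is at least dp/(1+dp). -/
theorem half_mul_le_one_sub_pow {p : ℝ} (hp0 : 0 ≤ p) (hp1 : p ≤ 1) {d : ℕ} (hd : d * p ≤ 1) :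
    d * p / 2 ≤ 1 - (1 - p) ^ d := by
  have hb := one_add_mul_le_pow (show (-2 : ℝ) ≤ p by linarith) d
  have hx : 0 ≤ (1 - p) ^ d := pow_nonneg (sub_nonneg.2 hp1) d
  have hp : (1 + p) ^ d * (1 - p) ^ d ≤ 1 := by
    rw [← mul_pow]
    exact pow_le_one₀ (by nlinarith) (by nlinarith [sq_nonneg p])
  have h2 := (mul_le_mul_of_nonneg_right hb hx).trans hp
  have hd0 : 0 ≤ d * p := by positivity
  nlinarith

/-! ### Choice of block lengths and the final bounds -/

theorem le_prob_le_LDS_of_sqrt_le {q : ℝ} (h0 : 1 / 2 ≤ q) (h1 : q < 1) {n L : ℕ}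
    (hL : 864 / √(1 - q) ≤ L) (hL' : (L : ℝ) ≤ 1 / (1 - q)) :
    1 - (1 - ((1 / 52488) / ((1 - q) * (L : ℝ) ^ 2)) ^ L) ^ ⌊(n : ℝ) * (1 - q) / 4⌋₊ ≤
      prob n q {σ | L ≤ LDS σ} := by
  have hq0 : 0 < q := by linarith
  have hq : 0 < 1 - q := sub_pos.2 h1
  have hsq : 0 < √(1 - q) := Real.sqrt_pos.2 hq
  have hL0 : (0 : ℝ) < L := lt_of_lt_of_le (by positivity) hL
  have hLn : 0 < L := by exact_mod_cast hL0
  have hLq : 1 ≤ (1 - q) * (L : ℝ) ^ 2 / 4 := by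
    rw [div_le_iff₀ hsq] at hL
    have h2 := mul_self_le_mul_self (by norm_num) hL
    have h3 := Real.mul_self_sqrt hq.le
    nlinarith
  rw [le_div_iff₀ hq] at hL'
  set m := ⌊4 / (1 - q)⌋₊ with hm
  have hm1 : (m : ℝ) * (1 - q) ≤ 4 := by
    rw [← le_div_iff₀ hq]
    exact Nat.floor_le (by positivity)
  have hm2 : 2 < (m : ℝ) * (1 - q) := by
    have := Nat.lt_floor_add_one (4 / (1 - q))
    rw [div_lt_iff₀ hq, ← hm] at this
    linarith
  -- The largest `d` for which `L` stages of length 2d fit in a block; L ≤ 1/(1-q) makes it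
  -- positive.
  set d := m / (2 * L) with hd
  have hmd : m < 2 * L * (d + 1) := Nat.lt_mul_div_succ m (by omega)
  have hdm : 2 * L * d ≤ m := Nat.mul_div_le m (2 * L)
  have hd1 : 1 ≤ d := by
    refine (Nat.one_le_div_iff (by omega)).2 ?_
    have : (2 * L : ℝ) * (1 - q) ≤ m * (1 - q) := by linarith
    exact_mod_cast le_of_mul_le_mul_right this hq
  have hdR : (1 : ℝ) ≤ d := by exact_mod_cast hd1
  have hmdR : (m : ℝ) < 2 * L * (d + 1) := by exact_mod_cast hmd
  have hdmR : (2 : ℝ) * L * d ≤ m := by exact_mod_cast hdm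
  have hu1 : L * d * (1 - q) ≤ 2 := by nlinarith
  have hm4 : (m : ℝ) ≤ 4 * (L * d) := by nlinarith
  have hu2 : 1 ≤ 2 * (L * d * (1 - q)) := by
    have := mul_le_mul_of_nonneg_right hm4 hq.le
    linarith
  have hd2 : (d : ℝ) * (d * (1 - q)) ≤ 1 := by
    have h2 : (L * d * (1 - q)) ^ 2 ≤ 2 ^ 2 := by gcongr
    have h3 : (L * d * (1 - q)) ^ 2 = ((1 - q) * (L : ℝ) ^ 2) * (d * (d * (1 - q))) := by ring
    have h4 : 0 ≤ (d : ℝ) * (d * (1 - q)) := by positivity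
    nlinarith [mul_le_mul_of_nonneg_right hLq h4]
  have hqm : 1 ≤ 9 ^ 4 * q ^ m := one_le_pow_mul_pow h0 h1 (by exact_mod_cast hm1)
  -- The divisor is 9^4, from q^m ≥ 9^(-4).
  set p : ℝ := d * (1 - q) / 6561 with hp
  have hp0 : 0 ≤ p := by positivity
  have hdp : d * p ≤ 1 := by
    rw [hp]
    linarith
  have hp1 : p ≤ 1 := by nlinarith
  -- A stage succeeds with probability at least dp/2 = d^2(1-q)/13122, and Ld(1-q) ≥ 1/2 turns this
  -- into the constant 1/(4·13122) = 1/52488.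
  have hs : (1 / 52488) / ((1 - q) * (L : ℝ) ^ 2) ≤ 1 - (1 - p) ^ d := by
    refine le_trans ?_ (half_mul_le_one_sub_pow hp0 hp1 hdp)
    rw [div_le_iff₀ (by positivity), hp]
    have h2 : 1 ≤ (2 * (L * d * (1 - q))) ^ 2 := one_le_pow₀ hu2
    nlinarith
  have hblock := pow_le_prob_le_LDS hq0 h1 hp0 hp1 (d := d) (m := m) (by
    rw [hp]
    have h2 : (0 : ℝ) ≤ d * (1 - q) := by positivity
    nlinarith) L (by rw [mul_right_comm]; exact hdm)
  refine le_prob_le_LDS_of_block hq0 ?_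
    ((pow_le_pow_left₀ (by positivity) hs L).trans hblock)
  have hb := Nat.floor_le (show 0 ≤ (n : ℝ) * (1 - q) / 4 by positivity)
  have : ((⌊(n : ℝ) * (1 - q) / 4⌋₊ : ℝ) * m) ≤ n := by
    calc (⌊(n : ℝ) * (1 - q) / 4⌋₊ : ℝ) * m ≤ (n : ℝ) * (1 - q) / 4 * m := by gcongr
      _ = n * (m * (1 - q)) / 4 := by ring
      _ ≤ n * 4 / 4 := by gcongr
      _ = n := by ring
  exact_mod_cast this

theorem prob_LDS_lt_le_rpow {q : ℝ} (h0 : 1 / 2 ≤ q) (h1 : q < 1) {n L : ℕ}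
    (hqn : q ≤ 1 - 4 / n) (hL2 : 2 ≤ L) (hL : (L : ℝ) < (1 / 52488) / √(1 - q)) (hn : 2 ≤ n) :
    prob n q {σ | LDS σ < L} ≤ (864 * (1 - q) * (L : ℝ) ^ 2) ^ ((n : ℝ) / L) := by
  have hq0 : 0 < q := by linarith
  have hq : 0 < 1 - q := sub_pos.2 h1
  have hn0 : (0 : ℝ) < n := by positivity
  have hsq : 0 < √(1 - q) := Real.sqrt_pos.2 hq
  have hL2R : (2 : ℝ) ≤ L := by exact_mod_cast hL2
  set y := 864 * (1 - q) * (L : ℝ) ^ 2 with hy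
  have hy0 : 0 < y := by positivity
  have hy1 : y ≤ 1 := by
    rw [lt_div_iff₀ hsq] at hL
    have h2 := mul_self_le_mul_self (by positivity) hL.le
    have h3 := Real.mul_self_sqrt hq.le
    nlinarith
  have hnq : 4 ≤ n * (1 - q) := by
    have : 4 / (n : ℝ) ≤ 1 - q := by linarith
    rwa [div_le_iff₀' hn0] at this
  set m := ⌊1 / (1 - q)⌋₊ with hm
  have hm1 : (m : ℝ) * (1 - q) ≤ 1 := by
    rw [← le_div_iff₀ hq]
    exact Nat.floor_le (by positivity)
  have hm2 : 1 / 2 ≤ (m : ℝ) * (1 - q) := by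
    have := Nat.lt_floor_add_one (1 / (1 - q))
    rw [div_lt_iff₀ hq, ← hm] at this
    linarith
  have hm0 : 0 < m := by
    rcases Nat.eq_zero_or_pos m with h | h
    · rw [h] at hm2
      norm_num at hm2
    · exact h
  have hmn : m ≤ n := by
    have : (m : ℝ) * (1 - q) ≤ n * (1 - q) := by linarith
    exact_mod_cast le_of_mul_le_mul_right this hq
  have hblock : prob m q {σ | LDS σ < L} ≤ y ^ m := by
    refine (prob_LDS_lt_le_div hq0 h1 m L).trans ?_
    have hZ := factorial_mul_pow_le_partitionFunction hq0 h1 (le_refl m)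
    have hqm : 1 ≤ 9 ^ 1 * q ^ m := one_le_pow_mul_pow h0 h1 (by exact_mod_cast hm1)
    have hm0R : (0 : ℝ) < m := by exact_mod_cast hm0
    -- The 27 combines 3 from m^m ≤ 3^m m! and 9 from q^m ≥ 1/9.
    have hZ' : ((m : ℝ) / 27) ^ m ≤ partitionFunction m q := by
      refine le_trans ?_ hZ
      rw [div_pow, div_le_iff₀ (by positivity)]
      calc (m : ℝ) ^ m ≤ 3 ^ m * m.factorial := pow_self_le m
        _ ≤ 3 ^ m * m.factorial * (9 ^ 1 * q ^ m) ^ m :=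
          le_mul_of_one_le_right (by positivity) (one_le_pow₀ hqm)
        _ = m.factorial * (q ^ m) ^ m * 27 ^ m := by
          rw [pow_one, mul_pow 9, show (27 : ℝ) = 3 * 9 by norm_num, mul_pow 3]
          ring
    calc ((L : ℝ) ^ 2) ^ m / partitionFunction m q ≤ ((L : ℝ) ^ 2) ^ m / ((m : ℝ) / 27) ^ m :=
          div_le_div_of_nonneg_left (by positivity) (by positivity) hZ'
      _ = ((L : ℝ) ^ 2 / ((m : ℝ) / 27)) ^ m := (div_pow _ _ _).symm
      _ ≤ y ^ m := by
          gcongr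
          rw [div_le_iff₀ (by positivity), hy]
          have : (0 : ℝ) < (L : ℝ) ^ 2 := by positivity
          nlinarith
  refine (prob_LDS_lt_le_pow hq0 L (Nat.div_mul_le_self n m)).trans ?_
  refine (pow_le_pow_left₀ (prob_nonneg m hq0 _) hblock _).trans ?_
  rw [← pow_mul, ← Real.rpow_natCast]
  refine Real.rpow_le_rpow_of_exponent_ge hy0 hy1 ?_
  -- Rounding down to whole blocks loses at most half of `n`; since y ≤ 1 and L ≥ 2, the exponent
  -- n/L is still small enough.
  have h2 : n < m * (n / m + 1) := Nat.lt_mul_div_succ n hm0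
  have h3 : 1 ≤ n / m := (Nat.one_le_div_iff hm0).2 hmn
  have h4 : n ≤ m * (n / m) * 2 := by nlinarith
  have h5 : (n : ℝ) ≤ (m * (n / m) : ℕ) * 2 := by exact_mod_cast h4
  rw [div_le_iff₀ (by linarith)]
  exact h5.trans (mul_le_mul_of_nonneg_left hL2R (by positivity))

theorem prob_le_LDS_le_of_long {q : ℝ} (h0 : 0 < q) (h1 : q < 1) (n : ℕ) {L : ℕ} (hL : 1 ≤ L)
    (hM : ⌈1 / (1 - q)⌉₊ ≤ L) :
    prob n q {σ | L ≤ LDS σ} ≤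
      n / (1 - q) * ((864 * (1 - q)) ^ L * q ^ (L * (L - 1) / 2)) := by
  have hq : 0 < 1 - q := sub_pos.2 h1
  refine (prob_le_LDS_le_meanCount h0 n L).trans ((meanCount_le_of_long h0 h1 n hL hM).trans ?_)
  gcongr
  norm_num

end Mallows

theorem theorem1p6 :
    ∃ C c : ℝ, 0 < C ∧ 0 < c ∧
      ∀ (n : ℕ) (q : ℝ), 2 ≤ n → 0 < q → q < 1 →
        -- upper bounds on the probability of a long decreasing subsequence
        (q < 1 - 2 / (n : ℝ) → ∀ L : ℕ, 2 ≤ L →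
          ((L : ℝ) ≤ 3 / (1 - q) →
            Mallows.prob n q {σ | L ≤ Mallows.LDS σ} ≤
              (n : ℝ) ^ 8 * (C / ((1 - q) * (L : ℝ) ^ 2)) ^ L) ∧
          (3 / (1 - q) < (L : ℝ) →
            Mallows.prob n q {σ | L ≤ Mallows.LDS σ} ≤
              (n : ℝ) ^ 8 * ((C * (1 - q)) ^ L * q ^ (L * (L - 1) / 2)))) ∧
        (q < 1 / 2 → ∀ L : ℕ, 2 ≤ L →
          Mallows.prob n q {σ | L ≤ Mallows.LDS σ} ≤
            (n : ℝ) * C ^ L * q ^ (L * (L - 1) / 2)) ∧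
        -- lower bounds on the probability of a long decreasing subsequence
        (1 / 2 ≤ q → q ≤ 1 - 4 / (n : ℝ) → ∀ L : ℕ,
          C / Real.sqrt (1 - q) ≤ (L : ℝ) → (L : ℝ) ≤ 1 / (1 - q) →
          1 - (1 - (c / ((1 - q) * (L : ℝ) ^ 2)) ^ L) ^ ⌊(n : ℝ) * (1 - q) / 4⌋₊ ≤
            Mallows.prob n q {σ | L ≤ Mallows.LDS σ}) ∧
        (∀ L : ℕ, 2 ≤ L →
          1 - (1 - q ^ (L * (L - 1) / 2) * (1 - q) ^ L) ^ ⌊(n : ℝ) / (L : ℝ)⌋₊ ≤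
            Mallows.prob n q {σ | L ≤ Mallows.LDS σ}) ∧
        -- upper bound on the probability that all decreasing subsequences are short
        (1 / 2 ≤ q → q ≤ 1 - 4 / (n : ℝ) → ∀ L : ℕ, 2 ≤ L →
          (L : ℝ) < c / Real.sqrt (1 - q) →
          Mallows.prob n q {σ | Mallows.LDS σ < L} ≤
            (C * (1 - q) * (L : ℝ) ^ 2) ^ ((n : ℝ) / (L : ℝ))) := by
  refine ⟨864, 1 / 52488, by norm_num, by norm_num, fun n q hn h0 h1 => ?_⟩
  have hq : 0 < 1 - q := sub_pos.2 h1
  have hn1 : (1 : ℝ) ≤ n := by exact_mod_cast (by omega : 1 ≤ n)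
  refine ⟨fun hqn L hL => ⟨fun _ => ?_, fun hL3 => ?_⟩, fun hq2 L hL => ?_,
    fun h0' _ L hL hL' => Mallows.le_prob_le_LDS_of_sqrt_le h0' h1 hL hL', fun L hL => ?_,
    fun h0' hqn L hL2 hL => Mallows.prob_LDS_lt_le_rpow h0' h1 hqn hL2 hL hn⟩
  · refine (Mallows.prob_le_LDS_le_meanCount h0 n L).trans
      ((Mallows.meanCount_le_of_short h0 h1 n hL).trans ?_)
    exact mul_le_mul_of_nonneg_right (le_self_pow₀ hn1 (by norm_num)) (by positivity)
  · have hM : ⌈1 / (1 - q)⌉₊ ≤ L := by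
      refine Nat.ceil_le.2 (le_trans ?_ hL3.le)
      gcongr
      norm_num
    refine (Mallows.prob_le_LDS_le_of_long h0 h1 n (by omega) hM).trans
      (mul_le_mul_of_nonneg_right ?_ (by positivity))
    -- Here q < 1-2/n turns the prefactor n/(1-q) into at most n^2.
    have hqn' : 2 < (1 - q) * n := by
      have : 2 / (n : ℝ) < 1 - q := by linarith
      rwa [div_lt_iff₀ (by linarith)] at this
    calc (n : ℝ) / (1 - q) ≤ n ^ 2 := by
          rw [div_le_iff₀ hq]
          nlinarith
      _ ≤ n ^ 8 := pow_le_pow_right₀ hn1 (by norm_num)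
  · have hM : ⌈1 / (1 - q)⌉₊ ≤ L := by
      refine Nat.ceil_le.2 ?_
      have : (2 : ℝ) ≤ L := by exact_mod_cast hL
      rw [div_le_iff₀ hq]
      nlinarith
    refine (Mallows.prob_le_LDS_le_of_long h0 h1 n (by omega) hM).trans ?_
    -- One factor 1-q of the power cancels the denominator of n/(1-q), so only `n` is left.
    have h2 : (1 - q) ^ L ≤ 1 - q := pow_le_of_le_one hq.le (by linarith) (by omega)
    calc (n : ℝ) / (1 - q) * ((864 * (1 - q)) ^ L * q ^ (L * (L - 1) / 2))
        = (n * 864 ^ L * q ^ (L * (L - 1) / 2)) * ((1 - q) ^ L / (1 - q)) := by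
          rw [mul_pow]
          ring
      _ ≤ (n : ℝ) * 864 ^ L * q ^ (L * (L - 1) / 2) :=
          mul_le_of_le_one_right (by positivity) ((div_le_one hq).2 h2)
  · refine Mallows.le_prob_le_LDS_of_block h0 ?_ (Mallows.le_prob_le_LDS_self h0 h1 L)
    have hL0 : (0 : ℝ) < L := by exact_mod_cast (by omega : 0 < L)
    have h2 := Nat.floor_le (show 0 ≤ (n : ℝ) / L by positivity)
    rw [le_div_iff₀ hL0] at h2
    exact_mod_cast h2
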